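/- **Setting.** An instance of the 0--1 knapsack problem (KP) consists of a finite list of items with profits $p_j$ and weights $w_j$ and of a capacity $c$, all non-negative integers; a set $S$ of items is feasible if $\sum_{j\in S} w_j\le c$, and its value is $\sum_{j\in S}p_j$. An instance of the 0--1 penalized knapsack problem (PKP) has in addition a penalty $\pi_j\in\mathbb Z_{\ge 0}$ for every item, the items $1,\dots,n$ being sorted so that $\pi_1\ge\dots\ge\pi_n$; the feasible sets are the same, and the value of $S$ is $\sum_{j\in S}p_j-\max_{j\in S}\pi_j$ (and $0$ for $S=\emptyset$). The case $n=0$ is allowed, and items may be heavier than the capacity. An FPTAS for a maximization problem, on a given class of instances, is a single program which, for every instance $I$ of the class and every rational $\varepsilon=a/b\in(0,1)$ (given by positive integers $a<b$), outputs a feasible solution of value at least $(1-\varepsilon)$ times the value of every feasible solution, in time polynomial in the bit size of the input $(\varepsilon,I)$ and in $1/\varepsilon$. (Programs are those of a WHILE language on binary trees with natural-number leaves, in which every operation is charged according to the bit lengths of its operands.) Let $K$ be an FPTAS for KP. For rational $\delta\in(0,1)$, algorithm $A(\delta)$ does the following on a PKP instance: for each item $j$ with $w_j\le c$ it packs $j$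 and runs $K$ with accuracy $\delta$ on the KP instance with items $j+1,\dots,n$ and capacity $c-w_j$; among the solutions so obtained and the empty set it returns one of the largest value, where the value of a solution found for $j$ is its profit minus $\pi_j$. **Proposition.** KP admits an FPTAS. Moreover, let $K$ be any FPTAS for KP and let $C>0$ be a rational constant. Then the algorithm that, given $\varepsilon$ and a PKP instance, runs $A(\varepsilon/C)$ (with $K$ as the subroutine) on this instance is an FPTAS for PKP on the class of all PKP instances with $\pi_j+1\le C$ for all items $j$. The polynomial that bounds its running time may depend on $C$ and $K$. -/

import Mathlib

namespace PKP

/-! ## The machine model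

A WHILE language over binary trees whose leaves are natural numbers, with logarithmic cost:
every operation is charged according to the bit lengths of the values that it touches.  Up to
polynomial factors its running times are those of Turing machines. -/

/-- Data values: natural numbers and pairs. -/
inductive Val : Type
  | num (n : ℕ) : Val
  | pair (a b : Val) : Val

namespace Val

/-- Number of bits needed to write a value down. -/
def size : Val → ℕ
  | num n => n.size + 1
  | pair a b => a.size + b.size + 1

/-- Numerical value of a leaf (`0` for a pair). -/
def toNat : Val → ℕ
  | num n => n
  | pair _ _ => 0

/-- First component (`0` for a leaf). -/
def fst : Val → Val
  | num _ => num 0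
  | pair a _ => a

/-- Second component (`0` for a leaf). -/
def snd : Val → Val
  | num _ => num 0
  | pair _ b => b

/-- A list as nested pairs that end in the leaf `0`. -/
def ofList : List Val → Val
  | [] => num 0
  | a :: l => pair a (ofList l)

end Val

/-- Binary operations: pairing and arithmetic on naturals (`sub` is truncated subtraction and
`div` is integer division). -/
inductive Op : Type
  | pair | add | sub | mul | div

/-- Meaning of the binary operations. -/
def Op.eval : Op → Val → Val → Val
  | .pair, a, b => .pair a b
  | .add, a, b => .num (a.toNat + b.toNat)
  | .sub, a, b => .num (a.toNat - b.toNat)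
  | .mul, a, b => .num (a.toNat * b.toNat)
  | .div, a, b => .num (a.toNat / b.toNat)

/-- Memory: variable `i` holds a value. -/
abbrev Store : Type := ℕ → Val

/-- Expressions. -/
inductive Expr : Type
  | var (i : ℕ) : Expr
  | num (n : ℕ) : Expr
  | fst (e : Expr) : Expr
  | snd (e : Expr) : Expr
  | bin (o : Op) (e₁ e₂ : Expr) : Expr

/-- Value of an expression. -/
def Expr.eval (s : Store) : Expr → Val
  | .var i => s i
  | .num n => .num n
  | .fst e => (e.eval s).fst
  | .snd e => (e.eval s).snd
  | .bin o e₁ e₂ => o.eval (e₁.eval s) (e₂.eval s)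

/-- Cost of evaluating an expression: reading a value costs its bit size, and a binary operation
costs the product of the bit sizes of its operands. -/
def Expr.cost (s : Store) : Expr → ℕ
  | .var i => (s i).size
  | .num n => (Val.num n).size
  | .fst e => e.cost s + 1
  | .snd e => e.cost s + 1
  | .bin _ e₁ e₂ => e₁.cost s + e₂.cost s + (e₁.eval s).size * (e₂.eval s).size

/-- Programs. A test succeeds when its expression has a value other than the leaf `0`.
`call i P e` runs the program `P` as a procedure, in a fresh memory, on the value of `e`, and
stores the result in variable `i`. -/
inductive Prog : Type
  | skip : Prog
  | assign (i : ℕ) (e : Expr) : Prog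
  | seq (P Q : Prog) : Prog
  | ite (e : Expr) (P Q : Prog) : Prog
  | while (e : Expr) (P : Prog) : Prog
  | call (i : ℕ) (P : Prog) (e : Expr) : Prog

/-- Fresh memory with the input in variable `0` and `0` everywhere else. -/
def Store.init (v : Val) : Store := Function.update (fun _ => Val.num 0) 0 v

/-- `Exec P s s' t`: started in memory `s`, the program `P` halts in memory `s'` after time `t`. -/
inductive Exec : Prog → Store → Store → ℕ → Prop
  | skip (s : Store) : Exec .skip s s 1
  | assign (s : Store) (i : ℕ) (e : Expr) :
      Exec (.assign i e) s (Function.update s i (e.eval s)) (e.cost s + 1)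
  | seq {P Q : Prog} {s s' s'' : Store} {t t' : ℕ} :
      Exec P s s' t → Exec Q s' s'' t' → Exec (.seq P Q) s s'' (t + t' + 1)
  | ite_true {e : Expr} {P Q : Prog} {s s' : Store} {t : ℕ} :
      e.eval s ≠ .num 0 → Exec P s s' t → Exec (.ite e P Q) s s' (e.cost s + t + 1)
  | ite_false {e : Expr} {P Q : Prog} {s s' : Store} {t : ℕ} :
      e.eval s = .num 0 → Exec Q s s' t → Exec (.ite e P Q) s s' (e.cost s + t + 1)
  | while_true {e : Expr} {P : Prog} {s s' s'' : Store} {t t' : ℕ} :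
      e.eval s ≠ .num 0 → Exec P s s' t → Exec (.while e P) s' s'' t' →
      Exec (.while e P) s s'' (e.cost s + t + t' + 1)
  | while_false {e : Expr} {P : Prog} {s : Store} :
      e.eval s = .num 0 → Exec (.while e P) s s (e.cost s + 1)
  | call {i : ℕ} {P : Prog} {e : Expr} {s s' : Store} {t : ℕ} :
      Exec P (Store.init (e.eval s)) s' t →
      Exec (.call i P e) s (Function.update s i (s' 0)) (e.cost s + t + (s' 0).size + 1)

/-- On input `v` the program `P` halts with output `r` (its variable `0`) after time `t`. -/
def Runs (P : Prog) (v r : Val) (t : ℕ) : Prop :=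
  ∃ s' : Store, Exec P (Store.init v) s' t ∧ s' 0 = r

/-- Programs are deterministic: memory and time at halting are determined by the start. -/
theorem Exec.det {P : Prog} {s s₁ s₂ : Store} {t₁ t₂ : ℕ}
    (h₁ : Exec P s s₁ t₁) (h₂ : Exec P s s₂ t₂) : s₁ = s₂ ∧ t₁ = t₂ := by
  induction h₁ generalizing s₂ t₂ with
  | skip s => cases h₂; exact ⟨rfl, rfl⟩
  | assign s i e => cases h₂; exact ⟨rfl, rfl⟩
  | seq _ _ ih ih' =>
    cases h₂ with
    | seq a b =>
      obtain ⟨rfl, rfl⟩ := ih a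
      obtain ⟨rfl, rfl⟩ := ih' b
      exact ⟨rfl, rfl⟩
  | ite_true he _ ih =>
    cases h₂ with
    | ite_true _ a => obtain ⟨rfl, rfl⟩ := ih a; exact ⟨rfl, rfl⟩
    | ite_false he' _ => exact absurd he' he
  | ite_false he _ ih =>
    cases h₂ with
    | ite_true he' _ => exact absurd he he'
    | ite_false _ a => obtain ⟨rfl, rfl⟩ := ih a; exact ⟨rfl, rfl⟩
  | while_true he _ _ ih ih' =>
    cases h₂ with
    | while_true _ a b =>
      obtain ⟨rfl, rfl⟩ := ih a
      obtain ⟨rfl, rfl⟩ := ih' b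
      exact ⟨rfl, rfl⟩
    | while_false he' => exact absurd he' he
  | while_false he =>
    cases h₂ with
    | while_true he' _ _ => exact absurd he he'
    | while_false _ => exact ⟨rfl, rfl⟩
  | call _ ih =>
    cases h₂ with
    | call a => obtain ⟨rfl, rfl⟩ := ih a; exact ⟨rfl, rfl⟩

/-! ## Maximization problems and approximation schemes -/

/-- A maximization problem whose solutions are 0-1 vectors. -/
structure MaxProblem where
  /-- Instances. -/
  Inst : Type
  /-- Encoding of an instance as input data. -/
  encode : Inst → Val
  /-- Feasible solutions. -/
  Feasible : Inst → List Bool → Prop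
  /-- Objective value of a solution. -/
  value : Inst → List Bool → ℤ

/-- Encoding of a 0-1 vector as output data. -/
def encodeBits (x : List Bool) : Val := Val.ofList (x.map fun b => Val.num b.toNat)

/-- Input data of an approximation scheme: the accuracy `a / b` and an instance. -/
def schemeInput (a b : ℕ) (v : Val) : Val := .pair (.pair (.num a) (.num b)) v

/-- `P` is a fully polynomial time approximation scheme for the maximization problem `M` on the
instances in `S`: for every instance and every rational accuracy `ε = a / b` in `(0, 1)` the one
program `P` outputs a feasible solution whose value is at least `1 - ε` times the value of every
feasible solution, in time polynomial in the size of the input and in `1 / ε`. -/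
def IsFPTAS (M : MaxProblem) (S : Set M.Inst) (P : Prog) : Prop :=
  ∃ q : Polynomial ℕ, ∀ I ∈ S, ∀ a b : ℕ, 0 < a → a < b →
    ∃ (x : List Bool) (t : ℕ),
      Runs P (schemeInput a b (M.encode I)) (encodeBits x) t ∧
      t ≤ q.eval ((schemeInput a b (M.encode I)).size + ⌈(b : ℚ) / (a : ℚ)⌉₊) ∧
      M.Feasible I x ∧
      ∀ y : List Bool, M.Feasible I y →
        (1 - (a : ℚ) / (b : ℚ)) * (M.value I y : ℚ) ≤ (M.value I x : ℚ)

/-! ## The two knapsack problems -/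

/-- Sum of `f` over the selected members of a list. -/
def selectedSum {α : Type} (f : α → ℕ) : List Bool → List α → ℕ
  | true :: x, a :: l => f a + selectedSum f x l
  | false :: x, _ :: l => selectedSum f x l
  | _, _ => 0

/-- Maximum of `f` over the selected members of a list (`0` if none is selected). -/
def selectedMax {α : Type} (f : α → ℕ) : List Bool → List α → ℕ
  | true :: x, a :: l => max (f a) (selectedMax f x l)
  | false :: x, _ :: l => selectedMax f x l
  | _, _ => 0

/-- An item of the 0-1 knapsack problem. -/
structure KItem where
  /-- Profit of the item. -/
  profit : ℕ
  /-- Weight of the item. -/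
  weight : ℕ

/-- An instance of the 0-1 knapsack problem. -/
structure KInst where
  /-- The items. -/
  items : List KItem
  /-- Capacity of the knapsack. -/
  cap : ℕ

/-- An item of the penalized knapsack problem. -/
structure Item extends KItem where
  /-- Penalty of the item. -/
  penalty : ℕ

/-- An instance of the penalized knapsack problem, with items in decreasing order of penalties. -/
structure Inst where
  /-- The items. -/
  items : List Item
  /-- Capacity of the knapsack. -/
  cap : ℕ
  /-- The penalties decrease weakly. -/
  sorted : items.Pairwise fun i j => j.penalty ≤ i.penalty

/-- Encoding of profit and weight of an item. -/
def KItem.encode (i : KItem) : Val := .pair (.num i.profit) (.num i.weight)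

/-- The 0-1 knapsack problem. -/
def knapsack : MaxProblem where
  Inst := KInst
  encode I := .pair (.num I.cap) (Val.ofList (I.items.map KItem.encode))
  Feasible I x := x.length = I.items.length ∧ selectedSum KItem.weight x I.items ≤ I.cap
  value I x := (selectedSum KItem.profit x I.items : ℤ)

/-- The 0-1 penalized knapsack problem: maximize the profit of the selected items minus the
greatest penalty of a selected item. Input data: capacity, list of profits and weights, list of
penalties. -/
def penalizedKnapsack : MaxProblem where
  Inst := Inst
  encode I := .pair (.num I.cap)
    (.pair (Val.ofList (I.items.map fun i => i.toKItem.encode))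
      (Val.ofList (I.items.map fun i => Val.num i.penalty)))
  Feasible I x :=
    x.length = I.items.length ∧ selectedSum (fun i : Item => i.weight) x I.items ≤ I.cap
  value I x :=
    (selectedSum (fun i : Item => i.profit) x I.items : ℤ) -
      (selectedMax Item.penalty x I.items : ℤ)

/-- The instances whose penalties `π` satisfy `π + 1 ≤ C`. -/
def boundedPenalties (C : ℚ) : Set penalizedKnapsack.Inst :=
  {I : Inst | ∀ i ∈ I.items, (i.penalty : ℚ) + 1 ≤ C}

/-! ## The approximation algorithm -/

open _root_.PKP.Expr _root_.PKP.Prog in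
/-- Input: a 0-1 vector and a list of (profit, weight) pairs. Output: the selected profit. -/
def packedProfit : Prog :=
  seq (assign 1 (fst (var 0))) <|                       -- the vector
  seq (assign 2 (snd (var 0))) <|                       -- the items
  seq (assign 0 (num 0)) <|                             -- the sum so far
  .while (var 1) <|
    seq (ite (fst (var 1)) (assign 0 (bin .add (var 0) (fst (fst (var 2))))) skip) <|
    seq (assign 1 (snd (var 1))) <|
    assign 2 (snd (var 2))

open _root_.PKP.Expr _root_.PKP.Prog in
/-- The algorithm `A(δ)`, with `K` as approximation algorithm for the knapsack problem.
Input: `δ` as a fraction, and an instance of the penalized knapsack problem.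

For every item `j` that fits into the knapsack (they are visited from the last one to the first
one), `j` is packed as leading item and `K` is run with accuracy `δ` on the items after `j` and
the remaining capacity. The best of these solutions and of the empty one is returned.

Variables: `1` is `δ`; `2` the capacity; `3` and `4` the items and the penalties not yet put on
the stack; `5` the stack of items; `6` the items after `j`, and `7` and `8` the best solution
found among these and its value; `9` the item `j` with its penalty; `10` the output of `K`, and
`11` the value of the solution that consists of `j` and of this output. -/
def algorithmA (K : Prog) : Prog :=
  seq (assign 1 (fst (var 0))) <|
  seq (assign 2 (fst (snd (var 0)))) <|
  seq (assign 3 (fst (snd (snd (var 0))))) <|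
  seq (assign 4 (snd (snd (snd (var 0))))) <|
  seq (assign 5 (num 0)) <|
  seq (.while (var 3) <|
    seq (assign 5 (bin .pair (bin .pair (fst (var 3)) (fst (var 4))) (var 5))) <|
    seq (assign 3 (snd (var 3))) <|
    assign 4 (snd (var 4))) <|
  seq (assign 6 (num 0)) <|
  seq (assign 7 (num 0)) <|
  seq (assign 8 (num 0)) <|
  seq (.while (var 5) <|
    seq (assign 9 (fst (var 5))) <|
    seq (assign 5 (snd (var 5))) <|
    seq (ite (bin .sub (snd (fst (var 9))) (var 2))
      -- the weight of `j` exceeds the capacity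
      (assign 7 (bin .pair (num 0) (var 7)))
      (seq (call 10 K
          (bin .pair (var 1) (bin .pair (bin .sub (var 2) (snd (fst (var 9)))) (var 6)))) <|
        seq (call 11 packedProfit (bin .pair (var 10) (var 6))) <|
        seq (assign 11 (bin .sub (bin .add (fst (fst (var 9))) (var 11)) (snd (var 9)))) <|
        ite (bin .sub (var 11) (var 8))
          -- the new value is greater than the best one so far
          (seq (assign 7 (bin .pair (num 1) (var 10))) (assign 8 (var 11)))
          (assign 7 (bin .pair (num 0) (var 7))))) <|
    assign 6 (bin .pair (fst (var 9)) (var 6))) <|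
  assign 0 (var 7)

open _root_.PKP.Expr _root_.PKP.Prog in
/-- The algorithm `A(δ)` with `δ = ε / C`. Input: `ε` as a fraction, and an instance. -/
def schemeA (C : ℚ) (K : Prog) : Prog :=
  call 0 (algorithmA K)
    (bin .pair
      (bin .pair (bin .mul (fst (fst (var 0))) (num C.den))
        (bin .mul (snd (fst (var 0))) (num C.num.toNat)))
      (snd (var 0)))

end PKP

/-! Penalized problem. Let `j` be the first selected item of a feasible set. Since penalties
decrease, its penalty `π` is the greatest one selected, so the value is `V = p + P - π`, where `p`
is the profit of `j` and `P` that of the later selected items, a knapsack solution for the remaining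
capacity. Running `K` with accuracy `ε / C` loses at most `(ε / C) * P`. If `V ≤ 0`, the empty set
is good enough. Otherwise `V ≥ 1` by integrality, hence `P ≤ V + π ≤ (1 + π) * V ≤ C * V`, and the
loss is at most `ε * V`. This is `penalized_le`; `IsApprox` carries the resulting guarantee from
each suffix of the item list to the next longer one.

Knapsack. Let `M` be the greatest profit of an item that fits, `n` the number of items and `N =
⌊1/ε⌋ + 1`. Profits are scaled to `⌊p * n * N / M⌋`, and a dynamic program keeps one lightest vector
for every total scaled profit. Rounding costs at most `M / (n * N)` per item, so `M / N` in all,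
while a single item already achieves `M` (`dpSolution_spec`). The number of totals is polynomial in
`n` and `1/ε`.

Running time. Loops and calls are charged a common bound `T`, and all memory a common size bound
`S`; for a fixed program the time is then a polynomial in `S` and `T` (`PolyBdd.prog`), and `Ends`
combines this with correctness. The dynamic program is assembled from closure properties of
`PolyTime`, the main one being `PolyTime.foldl`. The list of possible totals is exponential in the
bit size of its length, so it is written out separately by `countUp`. -/

namespace PKP

/-! ## Polynomial bounds -/

/-- `f` is bounded by a polynomial in the measure `μ`. -/
def PolyBdd {ι : Type*} (μ f : ι → ℕ) : Prop := ∃ q : Polynomial ℕ, ∀ i, f i ≤ q.eval (μ i)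

theorem eval_mono (q : Polynomial ℕ) {m n : ℕ} (h : m ≤ n) : q.eval m ≤ q.eval n := by
  simp only [Polynomial.eval_eq_sum_range]
  gcongr

namespace PolyBdd

variable {ι κ : Type*} {μ ν f g : ι → ℕ}

theorem self : PolyBdd μ μ := ⟨Polynomial.X, fun i => by simp⟩

theorem const (n : ℕ) : PolyBdd μ fun _ => n := ⟨Polynomial.C n, fun i => by simp⟩

theorem add (hf : PolyBdd μ f) (hg : PolyBdd μ g) : PolyBdd μ fun i => f i + g i := by
  obtain ⟨p, hp⟩ := hf
  obtain ⟨q, hq⟩ := hg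
  exact ⟨p + q, fun i => by rw [Polynomial.eval_add]; exact Nat.add_le_add (hp i) (hq i)⟩

theorem mul (hf : PolyBdd μ f) (hg : PolyBdd μ g) : PolyBdd μ fun i => f i * g i := by
  obtain ⟨p, hp⟩ := hf
  obtain ⟨q, hq⟩ := hg
  exact ⟨p * q, fun i => by rw [Polynomial.eval_mul]; exact Nat.mul_le_mul (hp i) (hq i)⟩

theorem mono (hg : PolyBdd μ g) (h : ∀ i, f i ≤ g i) : PolyBdd μ f := by
  obtain ⟨q, hq⟩ := hg
  exact ⟨q, fun i => (h i).trans (hq i)⟩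

theorem trans (hν : PolyBdd μ ν) (hf : PolyBdd ν f) : PolyBdd μ f := by
  obtain ⟨p, hp⟩ := hν
  obtain ⟨q, hq⟩ := hf
  refine ⟨q.comp p, fun i => (hq i).trans ?_⟩
  rw [Polynomial.eval_comp]
  exact eval_mono q (hp i)

theorem reindex (hf : PolyBdd μ f) (e : κ → ι) : PolyBdd (fun k => μ (e k)) fun k => f (e k) := by
  obtain ⟨q, hq⟩ := hf
  exact ⟨q, fun k => hq (e k)⟩

theorem eval (q : Polynomial ℕ) (hf : PolyBdd μ f) : PolyBdd μ fun i => q.eval (f i) :=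
  hf.trans ⟨q, fun _ => le_rfl⟩

end PolyBdd

/-! ## Sizes -/

theorem Val.size_pos (v : Val) : 0 < v.size := by
  cases v <;> simp [Val.size]

theorem Val.size_fst_le (v : Val) : v.fst.size ≤ v.size := by
  cases v <;> simp [Val.size, Val.fst]; omega

theorem Val.size_snd_le (v : Val) : v.snd.size ≤ v.size := by
  cases v <;> simp [Val.size, Val.snd]; omega

theorem Val.size_toNat_lt (v : Val) : v.toNat.size < v.size := by
  cases v <;> simp [Val.size, Val.toNat]

theorem size_add_le (m n : ℕ) : (m + n).size ≤ m.size + n.size + 1 := by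
  rw [Nat.size_le]
  have h₁ := Nat.lt_size_self m
  have h₂ := Nat.lt_size_self n
  have h₃ : 2 ^ m.size ≤ 2 ^ (m.size + n.size) := Nat.pow_le_pow_right (by norm_num) (by omega)
  have h₄ : 2 ^ n.size ≤ 2 ^ (m.size + n.size) := Nat.pow_le_pow_right (by norm_num) (by omega)
  rw [pow_succ]
  omega

theorem size_mul_le (m n : ℕ) : (m * n).size ≤ m.size + n.size := by
  rw [Nat.size_le, pow_add]
  exact Nat.mul_lt_mul'' (Nat.lt_size_self m) (Nat.lt_size_self n)

theorem size_le_self (n : ℕ) : n.size ≤ n := Nat.size_le.2 n.lt_two_pow_self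

/-- The product on the right is what a binary operation is charged; being at least 1, it also pays
for a pair node or a carry bit. -/
theorem Op.size_eval_le (o : Op) (a b : Val) :
    (o.eval a b).size ≤ a.size + b.size + a.size * b.size := by
  have ha := a.size_toNat_lt
  have hb := b.size_toNat_lt
  have hab : 0 < a.size * b.size := Nat.mul_pos a.size_pos b.size_pos
  cases o <;> simp only [Op.eval, Val.size]
  · omega
  · have := size_add_le a.toNat b.toNat; omega
  · have := Nat.size_le_size (Nat.sub_le a.toNat b.toNat); omega
  · have := size_mul_le a.toNat b.toNat; omega
  · have := Nat.size_le_size (Nat.div_le_self a.toNat b.toNat); omega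

/-- All variables hold values of size at most `S`. -/
def Store.Bdd (S : ℕ) (s : Store) : Prop := ∀ i, (s i).size ≤ S

theorem Store.Bdd.update {S : ℕ} {s : Store} (h : s.Bdd S) {i : ℕ} {v : Val} (hv : v.size ≤ S) :
    Store.Bdd S (Function.update s i v) := by
  intro j
  rcases eq_or_ne j i with rfl | hj
  · simpa using hv
  · simpa [hj] using h j

theorem Store.Bdd.init {S : ℕ} {v : Val} (h : v.size ≤ S) : (Store.init v).Bdd S := by
  refine Store.Bdd.update (fun i => ?_) h
  have := v.size_pos
  simp only [Val.size, Nat.size_zero]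
  omega

theorem Expr.size_eval_le_cost (s : Store) (e : Expr) : (e.eval s).size ≤ e.cost s := by
  induction e with
  | var i => exact le_rfl
  | num n => exact le_rfl
  | fst e ih => exact (Val.size_fst_le _).trans (ih.trans (Nat.le_succ _))
  | snd e ih => exact (Val.size_snd_le _).trans (ih.trans (Nat.le_succ _))
  | bin o e₁ e₂ ih₁ ih₂ =>
    have := o.size_eval_le (e₁.eval s) (e₂.eval s)
    simp only [Expr.eval, Expr.cost]
    omega

/-- Every write is charged at least the size of the value written, also when a call returns. So a
variable is either untouched or no larger than the elapsed time, and the maximum composes along a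
run. -/
theorem Exec.size_le {P : Prog} {s s' : Store} {t : ℕ} (h : Exec P s s' t) (i : ℕ) :
    (s' i).size ≤ max (s i).size t := by
  induction h with
  | skip s => exact le_max_left _ _
  | assign s j e =>
    rcases eq_or_ne i j with rfl | hj
    · have := e.size_eval_le_cost s
      simp only [Function.update_self]
      omega
    · simp [hj]
  | @call j P e s s' t _ _ =>
    rcases eq_or_ne i j with rfl | hj
    · simp only [Function.update_self]
      omega
    · simp [hj]
  | _ => omega

theorem Runs.size_le {P : Prog} {v r : Val} {t : ℕ} (h : Runs P v r t) : r.size ≤ v.size + t := by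
  obtain ⟨s, hs, rfl⟩ := h
  have := hs.size_le 0
  simp only [Store.init, Function.update_self] at this
  omega

/-! ## Total correctness with time bounds -/

/-- Bound for the cost of an expression when all variables have size at most `S`. -/
def Expr.bound (S : ℕ) : Expr → ℕ
  | .var _ => S
  | .num n => (Val.num n).size
  | .fst e => e.bound S + 1
  | .snd e => e.bound S + 1
  | .bin _ e₁ e₂ => e₁.bound S + e₂.bound S + e₁.bound S * e₂.bound S

theorem Expr.cost_le_bound {S : ℕ} {s : Store} (h : s.Bdd S) (e : Expr) :
    e.cost s ≤ e.bound S := by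
  induction e with
  | var i => exact h i
  | num n => exact le_rfl
  | fst e ih => exact Nat.succ_le_succ ih
  | snd e ih => exact Nat.succ_le_succ ih
  | bin o e₁ e₂ ih₁ ih₂ =>
    exact Nat.add_le_add (Nat.add_le_add ih₁ ih₂) (Nat.mul_le_mul
      ((e₁.size_eval_le_cost s).trans ih₁) ((e₂.size_eval_le_cost s).trans ih₂))

/-- Bound for the running time of a program when all variables have size at most `S` and every
loop and every procedure call take time at most `T`. -/
def Prog.bound (S T : ℕ) : Prog → ℕ
  | .skip => 1
  | .assign _ e => e.bound S + 1
  | .seq P Q => P.bound S T + Q.bound S T + 1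
  | .ite e P Q => e.bound S + (P.bound S T + Q.bound S T) + 1
  | .while _ _ => T
  | .call _ _ e => e.bound S + T + S + 1

theorem PolyBdd.expr {ι : Type*} {μ S : ι → ℕ} (hS : PolyBdd μ S) (e : Expr) :
    PolyBdd μ fun i => e.bound (S i) := by
  induction e with
  | var i => exact hS
  | num n => exact .const _
  | fst e ih => exact ih.add (.const 1)
  | snd e ih => exact ih.add (.const 1)
  | bin o e₁ e₂ ih₁ ih₂ => exact (ih₁.add ih₂).add (ih₁.mul ih₂)

/-- The program is fixed, so only `S` and `T` vary. All time estimates below reduce through this to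
polynomial bounds for the memory and for the single loops and calls. -/
theorem PolyBdd.prog {ι : Type*} {μ S T : ι → ℕ} (hS : PolyBdd μ S) (hT : PolyBdd μ T)
    (P : Prog) : PolyBdd μ fun i => P.bound (S i) (T i) := by
  induction P with
  | skip => exact .const 1
  | assign i e => exact (hS.expr e).add (.const 1)
  | seq P Q ihP ihQ => exact (ihP.add ihQ).add (.const 1)
  | ite e P Q ihP ihQ => exact ((hS.expr e).add (ihP.add ihQ)).add (.const 1)
  | call i P e ih => exact (((hS.expr e).add hT).add hS).add (.const 1)
  | _ => exact hT

/-- Started in memory `s`, the program `P` halts in a memory with property `Q`, within the time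
`P.bound S T`. -/
def Ends (S T : ℕ) (P : Prog) (s : Store) (Q : Store → Prop) : Prop :=
  ∃ s' t, Exec P s s' t ∧ t ≤ P.bound S T ∧ Q s'

namespace Ends

variable {S T : ℕ} {s : Store} {Q : Store → Prop}

theorem skip (h : Q s) : Ends S T .skip s Q := ⟨s, 1, .skip s, le_rfl, h⟩

theorem assign {i : ℕ} {e : Expr} (hs : s.Bdd S) (h : Q (Function.update s i (e.eval s))) :
    Ends S T (.assign i e) s Q :=
  ⟨_, _, .assign s i e, Nat.succ_le_succ (e.cost_le_bound hs), h⟩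

theorem seq {P P' : Prog} (h : Ends S T P s fun s' => Ends S T P' s' Q) :
    Ends S T (.seq P P') s Q := by
  obtain ⟨s', t, hP, ht, s'', t', hP', ht', hQ⟩ := h
  exact ⟨s'', _, .seq hP hP', by simp only [Prog.bound]; omega, hQ⟩

/-- Assignment as the first command of a sequence. -/
theorem assign_seq {i : ℕ} {e : Expr} {P : Prog} (hs : s.Bdd S)
    (h : Ends S T P (Function.update s i (e.eval s)) Q) :
    Ends S T (.seq (.assign i e) P) s Q := seq (assign hs h)

theorem ite {e : Expr} {P P' : Prog} (hs : s.Bdd S) (h : e.eval s ≠ .num 0 → Ends S T P s Q)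
    (h' : e.eval s = .num 0 → Ends S T P' s Q) : Ends S T (.ite e P P') s Q := by
  have he := e.cost_le_bound hs
  by_cases h₀ : e.eval s = .num 0
  · obtain ⟨s', t, hP, ht, hQ⟩ := h' h₀
    exact ⟨s', _, .ite_false h₀ hP, by simp only [Prog.bound]; omega, hQ⟩
  · obtain ⟨s', t, hP, ht, hQ⟩ := h h₀
    exact ⟨s', _, .ite_true h₀ hP, by simp only [Prog.bound]; omega, hQ⟩

theorem call {i : ℕ} {P : Prog} {e : Expr} {r : Val} {t : ℕ} (hs : s.Bdd S)
    (h : Runs P (e.eval s) r t) (ht : t ≤ T) (hr : r.size ≤ S) (hQ : Q (Function.update s i r)) :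
    Ends S T (.call i P e) s Q := by
  obtain ⟨s', hs', rfl⟩ := h
  have he := e.cost_le_bound hs
  exact ⟨_, _, .call hs', by simp only [Prog.bound]; omega, hQ⟩

/-- Loops: `I n` is the invariant when `n` iterations are left. -/
theorem while_exec {e : Expr} {P : Prog} {I : ℕ → Store → Prop} (hI : ∀ n s, I n s → s.Bdd S)
    (h₀ : ∀ s, I 0 s → e.eval s = .num 0)
    (h₁ : ∀ n s, I (n + 1) s → e.eval s ≠ .num 0 ∧ Ends S T P s (I n)) :
    ∀ (n : ℕ) (s : Store), I n s → ∃ s' t, Exec (.while e P) s s' t ∧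
      t ≤ (n + 1) * (e.bound S + P.bound S T + 1) ∧ I 0 s' := by
  intro n
  induction n with
  | zero =>
    intro s hs
    refine ⟨s, _, .while_false (h₀ s hs), ?_, hs⟩
    have := e.cost_le_bound (hI 0 s hs)
    omega
  | succ n ih =>
    intro s hs
    obtain ⟨he, s', t, hP, ht, hs'⟩ := h₁ n s hs
    obtain ⟨s'', t', hW, ht', hs''⟩ := ih s' hs'
    refine ⟨s'', _, .while_true he hP hW, ?_, hs''⟩
    have := e.cost_le_bound (hI _ s hs)
    rw [Nat.add_mul]
    omega

/-- The body has its own time parameter `T`; the whole loop is charged `T'` in the surrounding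
program, which avoids a circular choice of the bound. -/
theorem while_loop {T' n : ℕ} {e : Expr} {P : Prog} {I : ℕ → Store → Prop}
    (hI : ∀ n s, I n s → s.Bdd S) (h₀ : ∀ s, I 0 s → e.eval s = .num 0)
    (h₁ : ∀ n s, I (n + 1) s → e.eval s ≠ .num 0 ∧ Ends S T P s (I n))
    (hs : I n s) (hT : (n + 1) * (e.bound S + P.bound S T + 1) ≤ T') (hQ : ∀ s, I 0 s → Q s) :
    Ends S T' (.while e P) s Q := by
  obtain ⟨s', t, h, ht, hs'⟩ := while_exec hI h₀ h₁ n s hs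
  exact ⟨s', t, h, ht.trans hT, hQ s' hs'⟩

theorem runs {P : Prog} {v r : Val} (h : Ends S T P (Store.init v) fun s => s 0 = r) :
    ∃ t, Runs P v r t ∧ t ≤ P.bound S T := by
  obtain ⟨s, t, hP, ht, hr⟩ := h
  exact ⟨t, ⟨s, hP, hr⟩, ht⟩

end Ends

/-! ## Functions computable in polynomial time -/

/-- Types whose members are encoded as data values. -/
class Code (α : Type) where
  /-- The encoding. -/
  code : α → Val

open Code (code)

instance : Code ℕ := ⟨.num⟩
instance : Code Bool := ⟨fun b => .num b.toNat⟩
instance {α β : Type} [Code α] [Code β] : Code (α × β) := ⟨fun p => .pair (code p.1) (code p.2)⟩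
instance {α : Type} [Code α] : Code (List α) := ⟨fun l => Val.ofList (l.map code)⟩
instance : Code KItem := ⟨KItem.encode⟩

theorem code_nat (n : ℕ) : code n = .num n := rfl

theorem code_bool (b : Bool) : code b = .num b.toNat := rfl

theorem code_kitem (i : KItem) : code i = .pair (.num i.profit) (.num i.weight) := rfl

theorem code_pair {α β : Type} [Code α] [Code β] (a : α) (b : β) :
    code (a, b) = .pair (code a) (code b) := rfl

theorem code_nil {α : Type} [Code α] : code ([] : List α) = .num 0 := rfl

theorem code_cons {α : Type} [Code α] (a : α) (l : List α) :
    code (a :: l) = .pair (code a) (code l) := rfl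

/-- Size of the encoding. -/
def codeSize {α : Type} [Code α] (a : α) : ℕ := (code a).size

theorem codeSize_pos {α : Type} [Code α] (a : α) : 0 < codeSize a := Val.size_pos _

theorem codeSize_pair {α β : Type} [Code α] [Code β] (p : α × β) :
    codeSize p = codeSize p.1 + codeSize p.2 + 1 := rfl

theorem codeSize_nil {α : Type} [Code α] : codeSize ([] : List α) = 1 := rfl

theorem codeSize_cons {α : Type} [Code α] (a : α) (l : List α) :
    codeSize (a :: l) = codeSize a + codeSize l + 1 := rfl

theorem codeSize_nat (n : ℕ) : codeSize n = n.size + 1 := rfl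

theorem codeSize_le_of_mem {α : Type} [Code α] {a : α} {l : List α} (h : a ∈ l) :
    codeSize a ≤ codeSize l := by
  induction l with
  | nil => simp at h
  | cons b l ih =>
    rw [codeSize_cons]
    rcases List.mem_cons.1 h with rfl | h
    · omega
    · have := ih h; omega

theorem length_lt_codeSize {α : Type} [Code α] (l : List α) : l.length < codeSize l := by
  induction l with
  | nil => exact Nat.one_pos
  | cons b l ih => rw [codeSize_cons, List.length_cons]; omega

theorem codeSize_le_of_suffix {α : Type} [Code α] {l' l : List α} (h : l' <:+ l) :
    codeSize l' ≤ codeSize l := by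
  obtain ⟨l₁, rfl⟩ := h
  induction l₁ with
  | nil => exact le_rfl
  | cons b l ih => rw [List.cons_append, codeSize_cons]; omega

theorem codeSize_list_le {α : Type} [Code α] {l : List α} {n : ℕ} (h : ∀ a ∈ l, codeSize a ≤ n) :
    codeSize l ≤ l.length * (n + 1) + 1 := by
  induction l with
  | nil => simp [codeSize_nil]
  | cons b l ih =>
    have := ih fun a ha => h a (List.mem_cons_of_mem _ ha)
    have := h b List.mem_cons_self
    rw [codeSize_cons, List.length_cons, Nat.add_mul]
    omega

/-- `f` is computable in polynomial time. -/
def PolyTime {α β : Type} [Code α] [Code β] (f : α → β) : Prop :=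
  ∃ (P : Prog) (T : α → ℕ), PolyBdd codeSize T ∧
    ∀ a, ∃ t, Runs P (code a) (code (f a)) t ∧ t ≤ T a

namespace PolyTime

variable {α β γ σ : Type} [Code α] [Code β] [Code γ] [Code σ]

theorem polyBdd {f : α → β} (hf : PolyTime f) : PolyBdd codeSize fun a => codeSize (f a) := by
  obtain ⟨P, T, hT, h⟩ := hf
  refine (PolyBdd.self.add hT).mono fun a => ?_
  obtain ⟨t, ht, hle⟩ := h a
  exact ht.size_le.trans (Nat.add_le_add_left hle _)

/-- The functions given by expressions. -/
theorem expr {f : α → β} (e : Expr) (h : ∀ a, e.eval (Store.init (code a)) = code (f a)) :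
    PolyTime f := by
  refine ⟨.assign 0 e, _, PolyBdd.self.prog (.const 0) (.assign 0 e), fun a => ?_⟩
  exact Ends.runs (Ends.assign (Store.Bdd.init le_rfl) (by simpa using h a))

theorem comp {g : β → γ} {f : α → β} (hg : PolyTime g) (hf : PolyTime f) :
    PolyTime fun a => g (f a) := by
  have hgf := hf.polyBdd
  obtain ⟨P, T, hT, h⟩ := hf
  obtain ⟨P', T', hT', h'⟩ := hg
  have hT₁ : PolyBdd codeSize fun a => T' (f a) := hgf.trans (hT'.reindex f)
  have hgf' : PolyBdd codeSize fun a => codeSize (g (f a)) := by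
    refine (hgf.add hT₁).mono fun a => ?_
    obtain ⟨t, ht, hle⟩ := h' (f a)
    exact ht.size_le.trans (Nat.add_le_add_left hle _)
  refine ⟨.seq (.call 0 P (.var 0)) (.call 0 P' (.var 0)), _,
    ((PolyBdd.self.add hgf).add hgf').prog (hT.add hT₁) _, fun a => Ends.runs ?_⟩
  obtain ⟨t, ht, hle⟩ := h a
  obtain ⟨t', ht', hle'⟩ := h' (f a)
  have hs : Store.Bdd (codeSize a + codeSize (f a) + codeSize (g (f a)))
    (Store.init (code a)) := Store.Bdd.init (by change codeSize a ≤ _; omega)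
  have hm : (code (f a)).size ≤ codeSize a + codeSize (f a) + codeSize (g (f a)) := by
    change codeSize (f a) ≤ _; omega
  refine Ends.seq (Ends.call hs (by simpa [Expr.eval, Store.init] using ht) (by omega) hm ?_)
  exact Ends.call (hs.update hm) (by simpa [Expr.eval, Store.init] using ht') (by omega)
    (by change codeSize (g (f a)) ≤ _; omega) (by simp)

theorem pair {f : α → β} {g : α → γ} (hf : PolyTime f) (hg : PolyTime g) :
    PolyTime fun a => (f a, g a) := by
  have hf' := hf.polyBdd
  have hg' := hg.polyBdd
  obtain ⟨P, T, hT, h⟩ := hf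
  obtain ⟨P', T', hT', h'⟩ := hg
  refine ⟨.seq (.call 1 P (.var 0)) (.seq (.call 2 P' (.var 0))
    (.assign 0 (.bin .pair (.var 1) (.var 2)))), _,
    ((PolyBdd.self.add hf').add hg').prog (hT.add hT') _, fun a => Ends.runs ?_⟩
  obtain ⟨t, ht, hle⟩ := h a
  obtain ⟨t', ht', hle'⟩ := h' a
  have hs : Store.Bdd (codeSize a + codeSize (f a) + codeSize (g a))
    (Store.init (code a)) := Store.Bdd.init (by change codeSize a ≤ _; omega)
  have hm : (code (f a)).size ≤ codeSize a + codeSize (f a) + codeSize (g a) := by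
    change codeSize (f a) ≤ _; omega
  have hm' : (code (g a)).size ≤ codeSize a + codeSize (f a) + codeSize (g a) := by
    change codeSize (g a) ≤ _; omega
  refine Ends.seq (Ends.call hs (by simpa [Expr.eval, Store.init] using ht) (by omega) hm ?_)
  refine Ends.seq (Ends.call (hs.update hm)
    (by simpa [Expr.eval, Store.init] using ht') (by omega) hm' ?_)
  exact Ends.assign ((hs.update hm).update hm') (by simp [Expr.eval, Op.eval, code_pair])

theorem ite {t : α → ℕ} {f g : α → β} (ht : PolyTime t) (hf : PolyTime f) (hg : PolyTime g) :
    PolyTime fun a => if t a = 0 then f a else g a := by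
  have ht' := ht.polyBdd
  have hf' := hf.polyBdd
  have hg' := hg.polyBdd
  obtain ⟨P₀, T₀, hT₀, h₀⟩ := ht
  obtain ⟨P, T, hT, h⟩ := hf
  obtain ⟨P', T', hT', h'⟩ := hg
  -- A test succeeds on values other than `0`, so the program for `g` is the first branch.
  refine ⟨.seq (.call 1 P₀ (.var 0)) (.ite (.var 1) (.call 0 P' (.var 0)) (.call 0 P (.var 0))), _,
    (((PolyBdd.self.add ht').add hf').add hg').prog ((hT₀.add hT).add hT') _,
    fun a => Ends.runs ?_⟩
  obtain ⟨t₀, hr₀, hle₀⟩ := h₀ a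
  obtain ⟨t₁, hr, hle⟩ := h a
  obtain ⟨t₂, hr', hle'⟩ := h' a
  set S := codeSize a + codeSize (t a) + codeSize (f a) + codeSize (g a) with hS
  have hs : Store.Bdd S (Store.init (code a)) := Store.Bdd.init (by
    change codeSize a ≤ _; omega)
  have hm : (code (t a)).size ≤ S := by change codeSize (t a) ≤ _; omega
  refine Ends.seq (Ends.call hs (by simpa [Expr.eval, Store.init] using hr₀) (by omega) hm ?_)
  refine Ends.ite (hs.update hm) (fun hne => ?_) (fun he => ?_)
  · have hne' : t a ≠ 0 := by simpa [Expr.eval, code_nat] using hne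
    exact Ends.call (hs.update hm) (by simpa [Expr.eval, Store.init] using hr') (by omega)
      (by change codeSize (g a) ≤ _; omega) (by simp [hne'])
  · have he' : t a = 0 := by simpa [Expr.eval, code_nat] using he
    exact Ends.call (hs.update hm) (by simpa [Expr.eval, Store.init] using hr) (by omega)
      (by change codeSize (f a) ≤ _; omega) (by simp [he'])

/-- Iterating a polynomial-time step may blow up the accumulator. The a priori bound `B` on its size
after every prefix excludes this: each step then has an input of polynomial size, and there are at
most as many steps as the size of the list. -/
theorem foldl {L : α → List β} {z : α → σ} {g : α → σ → β → σ} (hL : PolyTime L)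
    (hz : PolyTime z) (hg : PolyTime fun p : α × σ × β => g p.1 p.2.1 p.2.2) {B : α → ℕ}
    (hB : PolyBdd codeSize B)
    (h : ∀ a l₁ l₂, L a = l₁ ++ l₂ → codeSize (l₁.foldl (g a) (z a)) ≤ B a) :
    PolyTime fun a => (L a).foldl (g a) (z a) := by
  have hL' := hL.polyBdd
  obtain ⟨P₁, T₁, hT₁, h₁⟩ := hL
  obtain ⟨P₂, T₂, hT₂, h₂⟩ := hz
  obtain ⟨P₃, T₃, ⟨q, hq⟩, h₃⟩ := hg
  have hS := (PolyBdd.self.add hL').add hB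
  -- The 2 counts the two pair nodes of the triple passed to the step program.
  have hT₄ := (hS.add (.const 2)).eval q
  let body : Prog := .seq
    (.call 2 P₃ (.bin .pair (.var 0) (.bin .pair (.var 2) (.fst (.var 1)))))
    (.assign 1 (.snd (.var 1)))
  have hW := hL'.mul (((hS.expr (.var 1)).add (hS.prog hT₄ body)).add (.const 1))
  refine ⟨.seq (.call 1 P₁ (.var 0)) (.seq (.call 2 P₂ (.var 0)) (.seq
    (.while (.var 1) body) (.assign 0 (.var 2)))), _, hS.prog ((hT₁.add hT₂).add hW) _,
    fun a => Ends.runs ?_⟩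
  obtain ⟨t₁, hr₁, hle₁⟩ := h₁ a
  obtain ⟨t₂, hr₂, hle₂⟩ := h₂ a
  beta_reduce
  set S := codeSize a + codeSize (L a) + B a with hSdef
  have hs : Store.Bdd S (Store.init (code a)) := Store.Bdd.init (by
    change codeSize a ≤ _; omega)
  have hm₁ : (code (L a)).size ≤ S := by change codeSize (L a) ≤ _; omega
  have hm₂ : (code (z a)).size ≤ S := by
    have := h a [] (L a) rfl
    change codeSize (z a) ≤ _
    exact this.trans (by omega)
  refine Ends.seq (Ends.call hs (by simpa [Expr.eval, Store.init] using hr₁) (by omega) hm₁ ?_)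
  refine Ends.seq (Ends.call (hs.update hm₁)
    (by simpa [Expr.eval, Store.init] using hr₂) (by omega) hm₂ ?_)
  refine Ends.seq (Ends.while_loop (S := S) (T := q.eval (S + 2)) (n := (L a).length)
    (I := fun n s => s.Bdd S ∧ s 0 = code a ∧ ∃ l₁ l₂, L a = l₁ ++ l₂ ∧ l₂.length = n ∧
      s 1 = code l₂ ∧ s 2 = code (l₁.foldl (g a) (z a))) (fun n s hI => hI.1) ?_ ?_ ?_ ?_ ?_)
  · rintro s ⟨-, -, l₁, l₂, -, hl, h1, -⟩
    rw [List.length_eq_zero_iff] at hl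
    simp [Expr.eval, h1, hl, code_nil]
  · rintro n s ⟨hb, h0, l₁, l₂, hl, hn, h1, h2⟩
    obtain ⟨b, l₂, rfl⟩ := List.exists_cons_of_length_eq_add_one hn
    refine ⟨by simp [Expr.eval, h1, code_cons], ?_⟩
    obtain ⟨t₃, hr₃, hle₃⟩ := h₃ (a, l₁.foldl (g a) (z a), b)
    have hb1 : codeSize (b :: l₂) ≤ codeSize (L a) := codeSize_le_of_suffix ⟨l₁, hl.symm⟩
    rw [codeSize_cons] at hb1
    have hb2 := h a l₁ (b :: l₂) hl
    have hl' : L a = (l₁ ++ [b]) ++ l₂ := by simp [hl]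
    have hb3 := h a _ _ hl'
    have hm : (code ((l₁ ++ [b]).foldl (g a) (z a))).size ≤ S := by
      change codeSize ((l₁ ++ [b]).foldl (g a) (z a)) ≤ S
      exact hb3.trans (by omega)
    refine Ends.seq (Ends.call (t := t₃) (r := code ((l₁ ++ [b]).foldl (g a) (z a))) hb ?_ ?_ hm ?_)
    · simpa [Expr.eval, Op.eval, h0, h1, h2, code_cons, Val.fst, code_pair] using hr₃
    · refine hle₃.trans ((hq _).trans (eval_mono q ?_))
      simp only [codeSize_pair]
      omega
    · refine Ends.assign (hb.update hm) ⟨(hb.update hm).update ?_, by simpa using h0,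
        l₁ ++ [b], l₂, hl', by simpa using hn, ?_, ?_⟩
      · simp only [Expr.eval, ne_eq, OfNat.one_ne_ofNat, not_false_eq_true,
          Function.update_of_ne, h1, code_cons, Val.snd]
        change codeSize l₂ ≤ S
        omega
      · simp [Expr.eval, h1, code_cons, Val.snd]
      · simp
  · refine ⟨(hs.update hm₁).update hm₂, by simp [Store.init], [], L a, rfl, rfl, by simp, by simp⟩
  · have := length_lt_codeSize (L a)
    refine le_trans (Nat.mul_le_mul_right _ this) ?_
    omega
  · rintro s ⟨hb, -, l₁, l₂, hl, hn, -, h2⟩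
    rw [List.length_eq_zero_iff] at hn
    refine Ends.assign hb ?_
    simp [Expr.eval, h2, hl, hn]

end PolyTime

/-! ### Closure of polynomial time under data operations, arithmetic and guarded folds. -/

namespace PolyTime

variable {α β γ σ : Type} [Code α] [Code β] [Code γ] [Code σ]

theorem id : PolyTime fun a : α => a := expr (.var 0) fun _ => rfl

theorem fst {f : α → β × γ} (hf : PolyTime f) : PolyTime fun a => (f a).1 :=
  comp (g := Prod.fst) (expr (.fst (.var 0)) fun _ => rfl) hf

theorem snd {f : α → β × γ} (hf : PolyTime f) : PolyTime fun a => (f a).2 :=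
  comp (g := Prod.snd) (expr (.snd (.var 0)) fun _ => rfl) hf

theorem nat (n : ℕ) : PolyTime fun _ : α => n := expr (.num n) fun _ => rfl

theorem bool (b : Bool) : PolyTime fun _ : α => b := expr (.num b.toNat) fun _ => rfl

theorem nil : PolyTime fun _ : α => ([] : List β) := expr (.num 0) fun _ => rfl

theorem cons {f : α → β} {g : α → List β} (hf : PolyTime f) (hg : PolyTime g) :
    PolyTime fun a => f a :: g a :=
  comp (g := fun p : β × List β => p.1 :: p.2) (expr (.var 0) fun _ => rfl) (hf.pair hg)

theorem profit {f : α → KItem} (hf : PolyTime f) : PolyTime fun a => (f a).profit :=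
  comp (g := KItem.profit) (expr (.fst (.var 0)) fun _ => rfl) hf

theorem weight {f : α → KItem} (hf : PolyTime f) : PolyTime fun a => (f a).weight :=
  comp (g := KItem.weight) (expr (.snd (.var 0)) fun _ => rfl) hf

theorem add {f g : α → ℕ} (hf : PolyTime f) (hg : PolyTime g) : PolyTime fun a => f a + g a :=
  comp (g := fun p : ℕ × ℕ => p.1 + p.2)
    (expr (.bin .add (.fst (.var 0)) (.snd (.var 0))) fun _ => rfl) (hf.pair hg)

theorem sub {f g : α → ℕ} (hf : PolyTime f) (hg : PolyTime g) : PolyTime fun a => f a - g a :=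
  comp (g := fun p : ℕ × ℕ => p.1 - p.2)
    (expr (.bin .sub (.fst (.var 0)) (.snd (.var 0))) fun _ => rfl) (hf.pair hg)

theorem mul {f g : α → ℕ} (hf : PolyTime f) (hg : PolyTime g) : PolyTime fun a => f a * g a :=
  comp (g := fun p : ℕ × ℕ => p.1 * p.2)
    (expr (.bin .mul (.fst (.var 0)) (.snd (.var 0))) fun _ => rfl) (hf.pair hg)

theorem div {f g : α → ℕ} (hf : PolyTime f) (hg : PolyTime g) : PolyTime fun a => f a / g a :=
  comp (g := fun p : ℕ × ℕ => p.1 / p.2)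
    (expr (.bin .div (.fst (.var 0)) (.snd (.var 0))) fun _ => rfl) (hf.pair hg)

/-- Folds that at each step either keep the accumulator or overwrite it by a function of the
current list member. -/
theorem foldl_select {L : α → List β} {z : α → σ} {t : α → σ → β → ℕ} {g : α → β → σ}
    (hL : PolyTime L) (hz : PolyTime z) (ht : PolyTime fun p : α × σ × β => t p.1 p.2.1 p.2.2)
    (hg : PolyTime fun p : α × β => g p.1 p.2) :
    PolyTime fun a => (L a).foldl (fun s b => if t a s b = 0 then g a b else s) (z a) := by
  obtain ⟨q, hq⟩ := hg.polyBdd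
  -- The accumulator is the initial value or one value of `g`, and `g` does not see the accumulator,
  -- so nothing grows along the fold.
  refine foldl (B := fun a => codeSize (z a) +
    q.eval (codeSize a + codeSize (L a) + 1)) hL hz
    (ite ht (comp hg (id.fst.pair id.snd.snd)) id.snd.fst)
    (hz.polyBdd.add (((PolyBdd.self.add hL.polyBdd).add (.const 1)).eval q)) ?_
  intro a l₁ l₂ hl
  have hmem : ∀ b ∈ l₁, b ∈ L a := fun b hb => by simp [hl, hb]
  have key : ∀ b ∈ l₁, codeSize (g a b) ≤
      q.eval (codeSize a + codeSize (L a) + 1) := by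
    refine fun b hb => (hq (a, b)).trans (eval_mono q ?_)
    have := codeSize_le_of_mem (hmem b hb)
    rw [codeSize_pair]
    exact Nat.succ_le_succ (Nat.add_le_add_left this _)
  clear hl hmem
  generalize q.eval (codeSize a + codeSize (L a) + 1) = M at key
  induction l₁ using List.reverseRecOn with
  | nil => exact Nat.le_add_right _ _
  | append_singleton l b ih =>
    rw [List.foldl_append, List.foldl_cons, List.foldl_nil]
    split
    · exact (key b (by simp)).trans (Nat.le_add_left _ _)
    · exact ih fun b' hb' => key b' (by simp [hb'])

/-- Folds that at each step keep the accumulator or put a function of the current list member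
in front of it. -/
theorem foldl_cons {L : α → List β} {t : α → β → ℕ} {g : α → β → γ} (hL : PolyTime L)
    (ht : PolyTime fun p : α × β => t p.1 p.2) (hg : PolyTime fun p : α × β => g p.1 p.2) :
    PolyTime fun a => (L a).foldl (fun l b => if t a b = 0 then g a b :: l else l) [] := by
  obtain ⟨q, hq⟩ := hg.polyBdd
  -- Each list member contributes at most one entry, of size bounded independently of the
  -- accumulator, together with its pair node.
  refine foldl (B := fun a => codeSize (L a) *
    (q.eval (codeSize a + codeSize (L a) + 1) + 1) + 1) hL nil
    (ite (comp ht (id.fst.pair id.snd.snd)) (cons (comp hg (id.fst.pair id.snd.snd)) id.snd.fst)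
      id.snd.fst)
    ((hL.polyBdd.mul ((((PolyBdd.self.add hL.polyBdd).add (.const 1)).eval q).add
      (.const 1))).add (.const 1)) ?_
  intro a l₁ l₂ hl
  have hmem : ∀ b ∈ l₁, b ∈ L a := fun b hb => by simp [hl, hb]
  have hlen : l₁.length ≤ codeSize (L a) := by
    have := length_lt_codeSize (L a)
    rw [hl, List.length_append] at this
    rw [hl]
    omega
  have key : ∀ b ∈ l₁, codeSize (g a b) ≤
      q.eval (codeSize a + codeSize (L a) + 1) := by
    refine fun b hb => (hq (a, b)).trans (eval_mono q ?_)
    have := codeSize_le_of_mem (hmem b hb)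
    rw [codeSize_pair]
    exact Nat.succ_le_succ (Nat.add_le_add_left this _)
  refine le_trans ?_ (Nat.succ_le_succ (Nat.mul_le_mul_right _ hlen))
  clear hl hmem hlen
  generalize q.eval (codeSize a + codeSize (L a) + 1) = M at key
  induction l₁ using List.reverseRecOn with
  | nil => simp [codeSize_nil]
  | append_singleton l b ih =>
    have ih := ih fun b' hb' => key b' (by simp [hb'])
    rw [List.foldl_append, List.foldl_cons, List.foldl_nil, List.length_append,
      List.length_singleton, Nat.add_mul, Nat.one_mul]
    split
    · rw [codeSize_cons]
      have := key b (by simp)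
      omega
    · omega

theorem reverse {L : α → List β} (hL : PolyTime L) : PolyTime fun a => (L a).reverse := by
  have h := foldl_cons (t := fun _ _ => 0) (g := fun _ b => b) hL (nat 0) id.snd
  simpa only [if_true, List.foldl_flip_cons_eq_append', List.append_nil] using h

theorem length {L : α → List β} (hL : PolyTime L) : PolyTime fun a => (L a).length := by
  have key : ∀ (l : List β) (n : ℕ), l.foldl (fun n _ => n + 1) n = n + l.length := by
    intro l
    induction l with
    | nil => intro n; rfl
    | cons b l ih => intro n; rw [List.foldl_cons, ih, List.length_cons]; omega
  have h := foldl (z := fun _ => 0) (g := fun _ n _ => n + 1) hL (nat 0)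
    (add id.snd.fst (nat 1)) (hL.polyBdd.add (.const 1)) ?_
  · simpa only [key, Nat.zero_add] using h
  · intro a l₁ l₂ hl
    have h₁ := length_lt_codeSize (L a)
    have h₂ := size_le_self l₁.length
    have h₃ : l₁.length ≤ (L a).length := by rw [hl, List.length_append]; omega
    rw [key, codeSize_nat, Nat.zero_add]
    omega

end PolyTime

/-! ## Dynamic programming for the knapsack problem -/

theorem mem_foldl_cons {β γ : Type} (t : β → ℕ) (g : β → γ) (c : γ) (L : List β) (l : List γ) :
    c ∈ L.foldl (fun l b => if t b = 0 then g b :: l else l) l ↔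
      c ∈ l ∨ ∃ b ∈ L, t b = 0 ∧ g b = c := by
  induction L generalizing l with
  | nil => simp
  | cons b L ih =>
    rw [List.foldl_cons, ih]
    split
    · rename_i h
      simp only [List.mem_cons, exists_eq_or_imp, h, true_and, eq_comm (a := c)]
      tauto
    · rename_i h
      simp [h]

theorem length_foldl_cons_le {β γ : Type} (t : β → ℕ) (g : β → γ) (L : List β) (l : List γ) :
    (L.foldl (fun l b => if t b = 0 then g b :: l else l) l).length ≤ L.length + l.length := by
  induction L generalizing l with
  | nil => simp
  | cons b L ih =>
    rw [List.foldl_cons]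
    refine (ih _).trans ?_
    split
    · simp; omega
    · simp

/-- Greatest profit of an item that fits into the knapsack. -/
def maxProfit (c : ℕ) (items : List KItem) : ℕ :=
  items.foldl (fun b i => if (i.weight - c) + (b - i.profit) = 0 then i.profit else b) 0

/-- A sum of truncated differences vanishes exactly when all the corresponding inequalities hold.
Guards in the folds are written this way because `PolyTime.ite` tests a number against zero. -/
theorem maxProfit_spec (c : ℕ) (items : List KItem) :
    (∀ i ∈ items, i.weight ≤ c → i.profit ≤ maxProfit c items) ∧
      (maxProfit c items = 0 ∨ ∃ i ∈ items, i.weight ≤ c ∧ i.profit = maxProfit c items) := by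
  have key : ∀ (l : List KItem) (b : ℕ), ∀ r, r = l.foldl
      (fun b i => if (i.weight - c) + (b - i.profit) = 0 then i.profit else b) b →
      b ≤ r ∧ (∀ i ∈ l, i.weight ≤ c → i.profit ≤ r) ∧
        (r = b ∨ ∃ i ∈ l, i.weight ≤ c ∧ i.profit = r) := by
    intro l
    induction l with
    | nil => simp
    | cons i l ih =>
      intro b r hr
      rw [List.foldl_cons] at hr
      obtain ⟨h₁, h₂, h₃⟩ := ih _ r hr
      split_ifs at h₁ h₃ with h
      · refine ⟨by omega, by simpa using ⟨fun _ => h₁, h₂⟩, ?_⟩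
        rcases h₃ with h₃ | ⟨i', hi', h₃⟩
        · exact .inr ⟨i, by simp, by omega, h₃.symm⟩
        · exact .inr ⟨i', by simp [hi'], h₃⟩
      · refine ⟨h₁, by simpa using ⟨fun _ => by omega, h₂⟩, ?_⟩
        rcases h₃ with h₃ | ⟨i', hi', h₃⟩
        · exact .inl h₃
        · exact .inr ⟨i', by simp [hi'], h₃⟩
  obtain ⟨-, h₂, h₃⟩ := key items 0 _ rfl
  exact ⟨h₂, h₃⟩

/-- States of the dynamic program: scaled profit, weight, and a 0-1 vector that has these. -/
abbrev DPState : Type := ℕ × ℕ × List Bool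

/-- The lightest among `b` and the extensions of the states in `L` by the decision `v` (which
adds `p` to the scaled profit and `w` to the weight) with scaled profit `k`. -/
def lightest (v : Bool) (p w k : ℕ) (b : ℕ × List Bool) (L : List DPState) : ℕ × List Bool :=
  L.foldl (fun b s => if (s.1 + p - k) + (k - (s.1 + p)) + (s.2.1 + w + 1 - b.1) = 0 then
    (s.2.1 + w, v :: s.2.2) else b) b

/-- In the guard, the first two differences express that the scaled profit equals `k`, and the
third, with its `+ 1`, that the new weight is strictly smaller than the current one. -/
theorem lightest_spec (v : Bool) (p w k : ℕ) (b : ℕ × List Bool) (L : List DPState) :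
    (lightest v p w k b L).1 ≤ b.1 ∧
      (∀ s ∈ L, s.1 + p = k → (lightest v p w k b L).1 ≤ s.2.1 + w) ∧
      (lightest v p w k b L = b ∨
        ∃ s ∈ L, s.1 + p = k ∧ lightest v p w k b L = (s.2.1 + w, v :: s.2.2)) := by
  induction L generalizing b with
  | nil => simp [lightest]
  | cons s L ih =>
    obtain ⟨h₁, h₂, h₃⟩ := ih (if (s.1 + p - k) + (k - (s.1 + p)) + (s.2.1 + w + 1 - b.1) = 0 then
      (s.2.1 + w, v :: s.2.2) else b)
    have hr : lightest v p w k b (s :: L) = lightest v p w k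
      (if (s.1 + p - k) + (k - (s.1 + p)) + (s.2.1 + w + 1 - b.1) = 0 then
      (s.2.1 + w, v :: s.2.2) else b) L := rfl
    rw [← hr] at h₁ h₂ h₃
    clear hr
    generalize lightest v p w k b (s :: L) = r at *
    split_ifs at h₁ h₃ with h
    · simp only at h₁
      refine ⟨by omega, by simpa using ⟨fun _ => h₁, fun a b c => h₂ (a, b, c)⟩, ?_⟩
      rcases h₃ with h₃ | ⟨s', hs', h₃⟩
      · exact .inr ⟨s, by simp, by omega, h₃⟩
      · exact .inr ⟨s', by simp [hs'], h₃⟩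
    · refine ⟨h₁, ?_, ?_⟩
      · intro s' hs' hk
        rcases List.mem_cons.1 hs' with rfl | hs'
        · omega
        · exact h₂ s' hs' hk
      rcases h₃ with h₃ | ⟨s', hs', h₃⟩
      · exact .inl h₃
      · exact .inr ⟨s', by simp [hs'], h₃⟩

/-- The lightest extension, with scaled profit `k`, of a state in `L` by a decision about an item
with scaled profit `p` and weight `w`; its weight exceeds `c` if there is none of weight at most
`c`. -/
def lightestExt (c p w : ℕ) (L : List DPState) (k : ℕ) : ℕ × List Bool :=
  lightest true p w k (lightest false 0 0 k (c + 1, []) L) L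

/-- One step of the dynamic program. -/
def dpStep (R : List ℕ) (c p w : ℕ) (L : List DPState) : List DPState :=
  R.foldl (fun l k => if (lightestExt c p w L k).1 - c = 0 then (k, lightestExt c p w L k) :: l
    else l) []

/-- The scaled profit of an item. -/
def scaledProfit (m M : ℕ) (i : KItem) : ℕ := i.profit * m / M

/-- The states of the dynamic program after all items have been treated. -/
def dpStates (R : List ℕ) (c m M : ℕ) (items : List KItem) : List DPState :=
  items.reverse.foldl (fun L i => dpStep R c (scaledProfit m M i) i.weight L) [(0, 0, [])]

/-- Items are treated from the last to the first, so that decisions put in front of a vector stay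
aligned with the item list. -/
theorem dpStates_cons (R : List ℕ) (c m M : ℕ) (i : KItem) (items : List KItem) :
    dpStates R c m M (i :: items) =
      dpStep R c (scaledProfit m M i) i.weight (dpStates R c m M items) := by
  simp [dpStates]

/-- A step creates at most one state per member of `R`; the extra 1 is for the initial state. This
keeps the table from doubling with each item. -/
theorem length_dpStates_le (R : List ℕ) (c m M : ℕ) (items : List KItem) :
    (dpStates R c m M items).length ≤ R.length + 1 := by
  cases items with
  | nil => simp [dpStates]
  | cons i items =>
    rw [dpStates_cons]
    exact (length_foldl_cons_le _ _ _ _).trans (by simp)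

theorem dpStates_sound (R : List ℕ) (c m M : ℕ) (items : List KItem) :
    ∀ s ∈ dpStates R c m M items, (s.1 ∈ R ∨ s.1 = 0) ∧ s.2.1 ≤ c ∧
      s.2.2.length = items.length ∧ s.1 = selectedSum (scaledProfit m M) s.2.2 items ∧
      s.2.1 = selectedSum KItem.weight s.2.2 items := by
  induction items with
  | nil =>
    intro s hs
    have : s = (0, 0, []) := by simpa [dpStates] using hs
    subst this
    simp [selectedSum]
  | cons i items ih =>
    intro s hs
    rw [dpStates_cons, dpStep, mem_foldl_cons] at hs
    rcases hs with hs | ⟨k, hk, hc, rfl⟩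
    · simp at hs
    refine ⟨.inl hk, by simp only; omega, ?_⟩
    obtain ⟨-, -, h₁⟩ := lightest_spec true (scaledProfit m M i) i.weight k
      (lightest false 0 0 k (c + 1, []) (dpStates R c m M items)) (dpStates R c m M items)
    obtain ⟨-, -, h₂⟩ := lightest_spec false 0 0 k (c + 1, []) (dpStates R c m M items)
    change lightestExt _ _ _ _ _ = _ ∨ (∃ s ∈ _, _ ∧ lightestExt _ _ _ _ _ = _) at h₁
    rcases h₁ with h₁ | ⟨s, hs, hp, h₁⟩
    -- If neither decision found a state, the start value of weight `c + 1` is left, which fails the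
    -- capacity test `hc`.
    · rcases h₂ with h₂ | ⟨s, hs, hp, h₂⟩
      · rw [h₁, h₂] at hc
        simp at hc
      · obtain ⟨-, -, h₃, h₄, h₅⟩ := ih s hs
        rw [h₁, h₂]
        simp only [selectedSum, List.length_cons]
        omega
    · obtain ⟨-, -, h₃, h₄, h₅⟩ := ih s hs
      rw [h₁]
      simp only [selectedSum, List.length_cons]
      omega

/-- Exchange argument: the tail of `y` may be replaced by a stored state with the same scaled profit
and no greater weight, and this state extended by the first decision of `y` competes for its entry
in the new table. -/
theorem dpStates_complete {R : List ℕ} {c m M B : ℕ} (hR : ∀ k ≤ B, k ∈ R) (items : List KItem)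
    (y : List Bool) (hy : y.length = items.length) (hw : selectedSum KItem.weight y items ≤ c)
    (hp : selectedSum (scaledProfit m M) y items ≤ B) :
    ∃ s ∈ dpStates R c m M items, s.1 = selectedSum (scaledProfit m M) y items ∧
      s.2.1 ≤ selectedSum KItem.weight y items := by
  induction items generalizing y with
  | nil =>
    obtain rfl : y = [] := List.length_eq_zero_iff.1 hy
    exact ⟨(0, 0, []), by simp [dpStates], rfl, le_rfl⟩
  | cons i items ih =>
    obtain ⟨v, y, rfl⟩ := List.exists_cons_of_length_eq_add_one hy
    have hy' : y.length = items.length := by simpa using hy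
    obtain ⟨h₁, h₂, -⟩ := lightest_spec true (scaledProfit m M i) i.weight
      (selectedSum (scaledProfit m M) (v :: y) (i :: items))
      (lightest false 0 0 (selectedSum (scaledProfit m M) (v :: y) (i :: items)) (c + 1, [])
        (dpStates R c m M items)) (dpStates R c m M items)
    obtain ⟨-, h₃, -⟩ := lightest_spec false 0 0
      (selectedSum (scaledProfit m M) (v :: y) (i :: items)) (c + 1, []) (dpStates R c m M items)
    have key : (lightestExt c (scaledProfit m M i) i.weight (dpStates R c m M items)
        (selectedSum (scaledProfit m M) (v :: y) (i :: items))).1 ≤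
          selectedSum KItem.weight (v :: y) (i :: items) := by
      cases v with
      | true =>
        simp only [selectedSum] at hw hp ⊢
        obtain ⟨s, hs, hs₁, hs₂⟩ := ih y hy' (by omega) (by omega)
        have := h₂ s hs (by simp only [selectedSum]; omega)
        simp only [selectedSum] at this
        exact this.trans (by omega)
      | false =>
        simp only [selectedSum] at hw hp ⊢
        obtain ⟨s, hs, hs₁, hs₂⟩ := ih y hy' (by omega) (by omega)
        have := h₃ s hs (by simp only [selectedSum]; omega)
        simp only [selectedSum] at this h₁
        -- The search over selecting extensions starts from the best rejecting one, so it can only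
        -- get lighter.
        exact h₁.trans (this.trans (by omega))
    refine ⟨(_, lightestExt c (scaledProfit m M i) i.weight (dpStates R c m M items) _), ?_,
      rfl, key⟩
    rw [dpStates_cons, dpStep, mem_foldl_cons]
    exact .inr ⟨_, hR _ hp, by omega, rfl⟩

/-- A state with greatest scaled profit. -/
def bestState (L : List DPState) : DPState :=
  L.foldl (fun b s => if b.1 - s.1 = 0 then s else b) (0, 0, [])

theorem bestState_spec {L : List DPState} (hL : L ≠ []) :
    bestState L ∈ L ∧ ∀ s ∈ L, s.1 ≤ (bestState L).1 := by
  have key : ∀ (L : List DPState) (b r : DPState),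
      r = L.foldl (fun b s => if b.1 - s.1 = 0 then s else b) b →
      b.1 ≤ r.1 ∧ r ∈ b :: L ∧ ∀ s ∈ L, s.1 ≤ r.1 := by
    intro L
    induction L with
    | nil => simp
    | cons s L ih =>
      intro b r hr
      rw [List.foldl_cons] at hr
      obtain ⟨h₁, h₂, h₃⟩ := ih _ r hr
      split_ifs at h₁ h₂ with h
      · exact ⟨by omega, List.mem_cons_of_mem _ h₂, List.forall_mem_cons.2 ⟨h₁, h₃⟩⟩
      · refine ⟨h₁, ?_, List.forall_mem_cons.2 ⟨by omega, h₃⟩⟩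
        rcases List.mem_cons.1 h₂ with h₂ | h₂ <;> simp [h₂]
  obtain ⟨s, L, rfl⟩ := List.exists_cons_of_ne_nil hL
  -- The start state has scaled profit 0 and is overwritten by the first member, so the result lies
  -- in the list.
  obtain ⟨h₁, h₂, h₃⟩ := key L s (bestState (s :: L)) (by simp [bestState])
  exact ⟨h₂, List.forall_mem_cons.2 ⟨h₁, h₃⟩⟩

/-- Solution found with the profits scaled to integers between `0` and `m`. -/
def dpSolution (R : List ℕ) (c m : ℕ) (items : List KItem) : List Bool :=
  (bestState (dpStates R c m (maxProfit c items) items)).2.2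

/-! ### Rounding error of the scaled dynamic program. -/

theorem selectedSum_mul_le {α : Type} {f g : α → ℕ} {a b d : ℕ} (x : List Bool) (l : List α)
    (h : ∀ i ∈ l, a * f i ≤ b * g i + d) :
    a * selectedSum f x l ≤ b * selectedSum g x l + d * l.length := by
  induction l generalizing x with
  | nil => cases x <;> simp [selectedSum]
  | cons i l ih =>
    have hi := h i (by simp)
    have h := fun x => ih x fun j hj => h j (by simp [hj])
    rcases x with - | ⟨_ | _, x⟩
    · simp [selectedSum]
    all_goals
      have := h x
      simp only [selectedSum, List.length_cons, Nat.mul_add, Nat.mul_one]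
      omega

/-- Every item selected by a feasible vector fits on its own, so `f` need only be bounded on such
items. -/
theorem selectedSum_le_length_mul {α : Type} {f w : α → ℕ} {c m : ℕ} (x : List Bool) (l : List α)
    (hw : selectedSum w x l ≤ c) (h : ∀ i ∈ l, w i ≤ c → f i ≤ m) :
    selectedSum f x l ≤ l.length * m := by
  induction l generalizing x with
  | nil => cases x <;> simp [selectedSum]
  | cons i l ih =>
    have hi := h i (by simp)
    have ih := fun x hx => ih x hx fun j hj => h j (by simp [hj])
    rcases x with - | ⟨_ | _, x⟩
    · simp [selectedSum]
    all_goals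
      simp only [selectedSum, List.length_cons, Nat.add_mul] at hw ⊢
      have := ih x (by omega)
      omega

theorem selectedSum_replicate_false {α : Type} (f : α → ℕ) (l : List α) :
    selectedSum f (List.replicate l.length false) l = 0 := by
  induction l with
  | nil => rfl
  | cons b l ih => simpa [List.replicate_succ, selectedSum] using ih

/-- The vector that selects a single member of a list. -/
theorem exists_select {α : Type} {l : List α} {a : α} (h : a ∈ l) :
    ∃ x : List Bool, x.length = l.length ∧ ∀ f : α → ℕ, selectedSum f x l = f a := by
  induction l with
  | nil => simp at h
  | cons b l ih =>
    rcases List.mem_cons.1 h with rfl | h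
    · exact ⟨true :: List.replicate l.length false, by simp,
        fun f => by simp [selectedSum, selectedSum_replicate_false]⟩
    · obtain ⟨x, hx, hf⟩ := ih h
      exact ⟨false :: x, by simp [hx], fun f => by simpa [selectedSum] using hf f⟩

/-- This is accuracy `1 / N`, multiplied by `N` to stay within the naturals. -/
theorem dpSolution_spec {R : List ℕ} {c N : ℕ} {items : List KItem} (hN : 0 < N)
    (hR : ∀ k ≤ items.length * (items.length * N), k ∈ R) :
    (dpSolution R c (items.length * N) items).length = items.length ∧
      selectedSum KItem.weight (dpSolution R c (items.length * N) items) items ≤ c ∧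
      ∀ y : List Bool, y.length = items.length → selectedSum KItem.weight y items ≤ c →
        N * selectedSum KItem.profit y items ≤
          N * selectedSum KItem.profit (dpSolution R c (items.length * N) items) items +
            selectedSum KItem.profit y items := by
  obtain ⟨hM, hM'⟩ := maxProfit_spec c items
  rw [dpSolution]
  generalize maxProfit c items = M at *
  set n := items.length with hn
  have hfeas : ∀ y : List Bool, y.length = n → selectedSum KItem.weight y items ≤ c →
      ∃ s ∈ dpStates R c (n * N) M items, s.1 = selectedSum (scaledProfit (n * N) M) y items := by
    intro y hy hyw
    have hyp : selectedSum (scaledProfit (n * N) M) y items ≤ n * (n * N) := by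
      refine selectedSum_le_length_mul y items hyw fun i hi hiw => ?_
      -- For `M = 0` the division by zero makes all scaled profits 0.
      rcases Nat.eq_zero_or_pos M with h0 | h0
      · simp [scaledProfit, h0]
      · rw [scaledProfit, Nat.div_le_iff_le_mul_add_pred h0]
        exact (Nat.mul_le_mul_right _ (hM i hi hiw)).trans (Nat.le_add_right _ _)
    obtain ⟨s, hs, hs₁, -⟩ := dpStates_complete hR items y hy hyw hyp
    exact ⟨s, hs, hs₁⟩
  have hne : dpStates R c (n * N) M items ≠ [] := by
    obtain ⟨s, hs, -⟩ := hfeas (List.replicate n false) (by simp) (by rw [hn, selectedSum_replicate_false]; omega)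
    exact List.ne_nil_of_mem hs
  obtain ⟨hb, hmax⟩ := bestState_spec hne
  generalize bestState (dpStates R c (n * N) M items) = b at *
  obtain ⟨-, hbc, hlen, hbp, hbw⟩ := dpStates_sound _ _ _ _ _ b hb
  refine ⟨hlen, hbw ▸ hbc, ?_⟩
  -- compared with any feasible vector, the loss is at most `M / N`
  have hloss : ∀ y : List Bool, y.length = n → selectedSum KItem.weight y items ≤ c →
      N * selectedSum KItem.profit y items ≤ N * selectedSum KItem.profit b.2.2 items + M := by
    intro y hy hyw
    rcases Nat.eq_zero_or_pos M with h0 | h0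
    · have := selectedSum_le_length_mul y items hyw (m := 0) fun i hi hiw => h0 ▸ hM i hi hiw
      rw [Nat.mul_zero, Nat.le_zero] at this
      simp [this]
    rcases Nat.eq_zero_or_pos n with hn0 | hn0
    · obtain rfl : y = [] := List.length_eq_zero_iff.1 (hy.trans hn0)
      simp [selectedSum]
    obtain ⟨s, hs, hs₁⟩ := hfeas y hy hyw
    have h₁ := hmax s hs
    rw [hs₁, hbp] at h₁
    have h₂ := selectedSum_mul_le (f := KItem.profit) (g := scaledProfit (n * N) M) (a := n * N)
      (b := M) (d := M) y items fun i _ => by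
        have := Nat.lt_div_mul_add h0 (a := i.profit * (n * N))
        rw [scaledProfit, Nat.mul_comm (n * N), Nat.mul_comm M]
        exact this.le
    have h₃ := selectedSum_mul_le (f := scaledProfit (n * N) M) (g := KItem.profit) (a := M)
      (b := n * N) (d := 0) b.2.2 items fun i _ => by
        rw [scaledProfit, Nat.mul_comm (n * N), Nat.add_zero]
        exact Nat.mul_div_le _ _
    have h₄ := Nat.mul_le_mul_left M h₁
    -- Rounding down loses at most `M` per item in `h₂` and nothing in `h₃`; the total `M * n` loses
    -- its factor `n` here.
    refine Nat.le_of_mul_le_mul_left (c := n) ?_ hn0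
    rw [← hn] at h₂
    rw [Nat.mul_add, ← Nat.mul_assoc, ← Nat.mul_assoc, Nat.mul_comm n M]
    omega
  intro y hy hyw
  have hy' := hloss y hy hyw
  -- The loss `M` is absorbed by the profit of `y` if that is at least `M`. Otherwise `y` is worse
  -- than the single item of profit `M`, and the estimate for that item suffices.
  by_cases hyM : M ≤ selectedSum KItem.profit y items
  · omega
  · rcases hM' with h0 | ⟨i, hi, hiw, hip⟩
    · omega
    · obtain ⟨x, hx, hxf⟩ := exists_select hi
      have hx' := hloss x hx (by rw [hxf]; exact hiw)
      rw [hxf, hip] at hx'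
      have : (N - 1) * selectedSum KItem.profit y items ≤ (N - 1) * M :=
        Nat.mul_le_mul_left _ (by omega)
      rw [Nat.sub_mul, Nat.sub_mul] at this
      have h₁ : M ≤ N * M := Nat.le_mul_of_pos_left _ hN
      omega

/-! ## A fully polynomial time approximation scheme for the knapsack problem -/

theorem codeSize_bool_le (b : Bool) : codeSize b ≤ 2 := by
  cases b <;> simp [codeSize, code, Val.size]

/-! ### The dynamic program runs in time polynomial in its input, with the list `R` counted in full.
-/

namespace PolyTime

variable {α : Type} [Code α]

theorem maxProfit {c : α → ℕ} {items : α → List KItem} (hc : PolyTime c)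
    (hitems : PolyTime items) : PolyTime fun a => maxProfit (c a) (items a) :=
  foldl_select (t := fun a b (i : KItem) => (i.weight - c a) + (b - i.profit))
    (g := fun _ i => i.profit) (z := fun _ => 0) hitems (nat 0)
    (add (sub (weight id.snd.snd) (comp hc id.fst)) (sub id.snd.fst (profit id.snd.snd)))
    (profit id.snd)

theorem lightest (v : Bool) {p w k : α → ℕ} {b : α → ℕ × List Bool} {L : α → List DPState}
    (hp : PolyTime p) (hw : PolyTime w) (hk : PolyTime k) (hb : PolyTime b) (hL : PolyTime L) :
    PolyTime fun a => lightest v (p a) (w a) (k a) (b a) (L a) := by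
  refine foldl_select (t := fun a b s => (s.1 + p a - k a) + (k a - (s.1 + p a)) +
    (s.2.1 + w a + 1 - b.1)) (g := fun a s => (s.2.1 + w a, v :: s.2.2)) hL hb ?_ ?_
  · have h₁ : PolyTime fun x : α × (ℕ × List Bool) × DPState => x.2.2.1 + p x.1 :=
      add id.snd.snd.fst (comp hp id.fst)
    have h₂ : PolyTime fun x : α × (ℕ × List Bool) × DPState => k x.1 := comp hk id.fst
    exact add (add (sub h₁ h₂) (sub h₂ h₁))
      (sub (add (add id.snd.snd.snd.fst (comp hw id.fst)) (nat 1)) id.snd.fst.fst)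
  · exact pair (add id.snd.snd.fst (comp hw id.fst)) (cons (bool v) id.snd.snd.snd)

theorem lightestExt {c p w k : α → ℕ} {L : α → List DPState} (hc : PolyTime c)
    (hp : PolyTime p) (hw : PolyTime w) (hL : PolyTime L) (hk : PolyTime k) :
    PolyTime fun a => lightestExt (c a) (p a) (w a) (L a) (k a) :=
  lightest true hp hw hk (lightest false (nat 0) (nat 0) hk (pair (add hc (nat 1)) nil) hL) hL

theorem dpStep {R : α → List ℕ} {c p w : α → ℕ} {L : α → List DPState} (hR : PolyTime R)
    (hc : PolyTime c) (hp : PolyTime p) (hw : PolyTime w) (hL : PolyTime L) :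
    PolyTime fun a => dpStep (R a) (c a) (p a) (w a) (L a) := by
  have h : PolyTime fun x : α × ℕ => PKP.lightestExt (c x.1) (p x.1) (w x.1) (L x.1) x.2 :=
    lightestExt (comp hc id.fst) (comp hp id.fst) (comp hw id.fst) (comp hL id.fst) id.snd
  exact foldl_cons (t := fun a k => (PKP.lightestExt (c a) (p a) (w a) (L a) k).1 - c a)
    (g := fun a k => (k, PKP.lightestExt (c a) (p a) (w a) (L a) k)) hR
    (sub h.fst (comp hc id.fst)) (pair id.snd h)

/-- Soundness of the table bounds its size: each scaled profit is 0 or a member of `R`, each weight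
is at most `c`, each vector is no longer than the item list, and there are at most `R.length + 1`
states. -/
theorem dpStates {R : α → List ℕ} {c m M : α → ℕ} {items : α → List KItem} (hR : PolyTime R)
    (hc : PolyTime c) (hm : PolyTime m) (hM : PolyTime M) (hitems : PolyTime items) :
    PolyTime fun a => dpStates (R a) (c a) (m a) (M a) (items a) := by
  have hB : PolyBdd codeSize fun a => codeSize (R a) *
      (codeSize (R a) + (codeSize (c a) + (codeSize (items a) * 3 + 1) + 1) + 1 + 1) + 1 :=
    (hR.polyBdd.mul ((((hR.polyBdd.add ((hc.polyBdd.add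
      ((hitems.polyBdd.mul (.const 3)).add (.const 1))).add (.const 1)))).add
      (.const 1)).add (.const 1))).add (.const 1)
  refine foldl (z := fun _ => [(0, 0, [])])
    (g := fun a L i => PKP.dpStep (R a) (c a) (scaledProfit (m a) (M a) i) i.weight L)
    hitems.reverse (cons (pair (nat 0) (pair (nat 0) nil)) nil)
    (dpStep (comp hR id.fst) (comp hc id.fst)
      (div (mul id.snd.snd.profit (comp hm id.fst)) (comp hM id.fst)) id.snd.snd.weight
      id.snd.fst) hB ?_
  intro a l₁ l₂ hl
  have hlen : l₁.length ≤ (items a).length := by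
    rw [← List.length_reverse (as := items a), hl, List.length_append]
    omega
  -- The accumulator after the prefix `l₁` of the reversed items is itself the table for the items
  -- `l₁.reverse`.
  have h₁ := length_dpStates_le (R a) (c a) (m a) (M a) l₁.reverse
  have h₂ := dpStates_sound (R a) (c a) (m a) (M a) l₁.reverse
  rw [PKP.dpStates, List.reverse_reverse] at h₁ h₂
  refine (codeSize_list_le (n := codeSize (R a) +
    (codeSize (c a) + (codeSize (items a) * 3 + 1) + 1) + 1) fun s hs => ?_).trans ?_
  · obtain ⟨hs₁, hs₂, hs₃, -⟩ := h₂ s hs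
    rw [codeSize_pair, codeSize_pair]
    have h₃ : codeSize s.1 ≤ codeSize (R a) := by
      rcases hs₁ with h | h
      · exact codeSize_le_of_mem h
      · rw [h]; exact codeSize_pos _
    have h₄ : codeSize s.2.1 ≤ codeSize (c a) := Nat.succ_le_succ (Nat.size_le_size hs₂)
    have h₅ : codeSize s.2.2 ≤ s.2.2.length * (2 + 1) + 1 :=
      codeSize_list_le fun b _ => codeSize_bool_le b
    have h₆ := length_lt_codeSize (items a)
    rw [hs₃, List.length_reverse] at h₅
    omega
  · have := length_lt_codeSize (R a)
    exact Nat.succ_le_succ (Nat.mul_le_mul_right _ (h₁.trans this))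

theorem bestState {L : α → List DPState} (hL : PolyTime L) : PolyTime fun a => bestState (L a) :=
  foldl_select (t := fun _ (b s : DPState) => b.1 - s.1) (g := fun _ s => s)
    (z := fun _ => (0, 0, [])) hL (pair (nat 0) (pair (nat 0) nil)) (sub id.snd.fst.fst id.snd.snd.fst) id.snd

theorem dpSolution {R : α → List ℕ} {c m : α → ℕ} {items : α → List KItem} (hR : PolyTime R)
    (hc : PolyTime c) (hm : PolyTime m) (hitems : PolyTime items) :
    PolyTime fun a => dpSolution (R a) (c a) (m a) (items a) :=
  (bestState (dpStates hR hc hm (maxProfit hc hitems) hitems)).snd.snd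

end PolyTime

/-! ### Writing out the list of possible scaled profits. -/

/-- Input: a number `n` and a value. Output: the list of the numbers up to `n`, and the value. -/
def countUp : Prog :=
  .seq (.assign 1 (.num 0)) <|
  .seq (.assign 2 (.fst (.var 0))) <|
  .seq (.while (.var 2) <|
    .seq (.assign 1 (.bin .pair (.var 2) (.var 1))) <|
    .assign 2 (.bin .sub (.var 2) (.num 1))) <|
  .assign 0 (.bin .pair (.bin .pair (.num 0) (.var 1)) (.snd (.var 0)))

/-- The bound is polynomial in the number `n` and not in its bit size, so this is not a case of
`PolyTime`; here the dependence on `1/ε` enters. -/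
theorem countUp_runs {α : Type} [Code α] : ∃ q : Polynomial ℕ, ∀ (n : ℕ) (a : α), ∃ t,
    Runs countUp (code (n, a)) (code (List.range (n + 1), a)) t ∧ t ≤ q.eval (n + codeSize a) := by
  let μ : ℕ × α → ℕ := fun i => i.1 + codeSize i.2
  have hn : PolyBdd μ fun i => i.1 := PolyBdd.self.mono fun i => Nat.le_add_right _ _
  have ha : PolyBdd μ fun i => codeSize i.2 := PolyBdd.self.mono fun i => Nat.le_add_left _ _
  have hS : PolyBdd μ fun i => (i.1 + 1) * (i.1 + 2 + 1) + 1 + i.1 + codeSize i.2 + 3 :=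
    ((((((hn.add (.const 1)).mul ((hn.add (.const 2)).add (.const 1))).add
      (.const 1)).add hn).add ha).add (.const 3))
  let body : Prog := .seq (.assign 1 (.bin .pair (.var 2) (.var 1)))
    (.assign 2 (.bin .sub (.var 2) (.num 1)))
  have hT := (hn.add (.const 1)).mul
    (((hS.expr (.var 2)).add (hS.prog (.const 0) body)).add (.const 1))
  obtain ⟨q, hq⟩ := hS.prog hT countUp
  refine ⟨q, fun n a => ?_⟩
  have hq := hq (n, a)
  simp only at hq
  suffices h : ∃ t, Runs countUp (code (n, a)) (code (List.range (n + 1), a)) t ∧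
      t ≤ countUp.bound ((n + 1) * (n + 2 + 1) + 1 + n + codeSize a + 3) _ by
    obtain ⟨t, ht, hle⟩ := h
    exact ⟨t, ht, hle.trans hq⟩
  set S := (n + 1) * (n + 2 + 1) + 1 + n + codeSize a + 3 with hSdef
  have hcode : ∀ k ≤ n, codeSize k ≤ n + 2 := fun k hk => by
    have := size_le_self k
    rw [codeSize_nat]; omega
  have hlist : ∀ k ≤ n, codeSize ((List.range (n + 1)).drop (k + 1)) ≤ S := by
    intro k hk
    refine (codeSize_list_le (n := n + 2) fun j hj => hcode j ?_).trans ?_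
    · have := List.mem_of_mem_drop hj
      rw [List.mem_range] at this
      omega
    · have : ((List.range (n + 1)).drop (k + 1)).length * (n + 2 + 1) ≤ (n + 1) * (n + 2 + 1) :=
        Nat.mul_le_mul_right _ (by simp; omega)
      omega
  have hs : Store.Bdd S (Store.init (code (n, a))) := Store.Bdd.init (by
    have := hcode n le_rfl
    change codeSize (n, a) ≤ S
    rw [codeSize_pair]; simp only; omega)
  have h1 : (Val.num 0).size ≤ S := by simp [Val.size]; omega
  have h2 : (Val.num n).size ≤ S := by
    have := hcode n le_rfl
    change codeSize n ≤ S
    omega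
  refine Ends.runs (Ends.assign_seq hs (Ends.assign_seq (hs.update h1) (Ends.seq ?_)))
  refine Ends.while_loop (S := S) (T := 0) (n := n) (I := fun k s => s.Bdd S ∧ k ≤ n ∧
    s 0 = code (n, a) ∧ s 1 = code ((List.range (n + 1)).drop (k + 1)) ∧ s 2 = code k)
    (fun k s hI => hI.1) ?_ ?_ ?_ le_rfl ?_
  · rintro s ⟨-, -, -, -, h⟩
    simpa [Expr.eval, code_nat] using h
  · rintro k s ⟨hb, hk, hs0, hs1, hs2⟩
    refine ⟨by simp [Expr.eval, hs2, code_nat], ?_⟩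
    have hdrop : (List.range (n + 1)).drop (k + 1) =
        (k + 1) :: (List.range (n + 1)).drop (k + 1 + 1) := by
      rw [List.drop_eq_getElem_cons (by simpa using by omega)]
      simp
    have hb' : Store.Bdd S (Function.update s 1 (code ((List.range (n + 1)).drop (k + 1)))) :=
      hb.update (hlist k (by omega))
    have he : Expr.eval s (.bin .pair (.var 2) (.var 1)) =
        code ((List.range (n + 1)).drop (k + 1)) := by
      rw [hdrop]; simp [Expr.eval, Op.eval, hs1, hs2, code_cons]
    refine Ends.assign_seq hb ?_
    rw [he]
    have hm : (Val.num k).size ≤ S := by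
      have := hcode k (by omega)
      change codeSize k ≤ S
      omega
    refine Ends.assign hb' ?_
    have he' : Expr.eval (Function.update s 1 (code ((List.range (n + 1)).drop (k + 1))))
        (.bin .sub (.var 2) (.num 1)) = .num k := by
      simp [Expr.eval, Op.eval, hs2, code_nat, Val.toNat]
    rw [he']
    exact ⟨hb'.update hm, by omega, by simpa using hs0, by simp, by simp [code_nat]⟩
  · refine ⟨(hs.update h1).update ?_, le_rfl, by simp [Store.init], ?_, ?_⟩
    · simpa [Expr.eval, Store.init, code_pair, Val.fst, code_nat] using h2
    · rw [List.drop_eq_nil_of_le (by simp), code_nil]; simp [Expr.eval]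
    · simp [Expr.eval, Store.init, code_pair, Val.fst]
  · rintro s ⟨hb, -, hs0, hs1, -⟩
    refine Ends.assign hb ?_
    -- The loop stops when the counter is 0, so the final assignment supplies the leading 0.
    have : List.range (n + 1) = 0 :: (List.range (n + 1)).drop 1 := by
      rw [List.range_succ_eq_map]; simp
    rw [this]
    simp [Expr.eval, Op.eval, hs0, hs1, code_cons, code_pair, Val.snd, code_nat]

/-- Run `P`, and then `P'` on its output. -/
def chain (P P' : Prog) : Prog := .seq (.call 0 P (.var 0)) (.call 0 P' (.var 0))

theorem chain_runs {P P' : Prog} {v r r' : Val} {t t' : ℕ} (h : Runs P v r t)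
    (h' : Runs P' r r' t') :
    ∃ t₀, Runs (chain P P') v r' t₀ ∧ t₀ ≤ 4 * v.size + 4 * t + 2 * t' + 3 := by
  have hr := h.size_le
  have hr' := h'.size_le
  obtain ⟨s, hs, rfl⟩ := h
  obtain ⟨s', hs', rfl⟩ := h'
  refine ⟨_, ⟨_, .seq (.call (by simpa [Expr.eval, Store.init] using hs))
    (.call (by simpa [Expr.eval] using hs')), by simp⟩, ?_⟩
  simp only [Expr.cost, Store.init, Function.update_self]
  omega

/-- Input of the knapsack scheme. -/
abbrev SchemeInput : Type := (ℕ × ℕ) × ℕ × List KItem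

/-- Preparation of the dynamic program: greatest possible scaled profit, instance, and
scaled value of the greatest profit of an item. -/
def prepare (i : SchemeInput) : ℕ × (ℕ × List KItem) × ℕ :=
  (i.2.2.length * (i.2.2.length * (i.1.2 / i.1.1 + 1)), i.2,
    i.2.2.length * (i.1.2 / i.1.1 + 1))

theorem polyTime_prepare : PolyTime prepare := by
  have hn : PolyTime fun i : SchemeInput => i.2.2.length := .length (.snd (.snd .id))
  have hN : PolyTime fun i : SchemeInput => i.1.2 / i.1.1 + 1 :=
    .add (.div (.snd (.fst .id)) (.fst (.fst .id))) (.nat 1)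
  exact .pair (.mul hn (.mul hn hN)) (.pair (.snd .id) (.mul hn hN))

theorem polyTime_solve : PolyTime fun i : List ℕ × (ℕ × List KItem) × ℕ =>
    dpSolution i.1 i.2.1.1 i.2.2 i.2.1.2 :=
  .dpSolution (.fst .id) (.fst (.fst (.snd .id))) (.snd (.snd .id)) (.snd (.fst (.snd .id)))

theorem div_le_ceil (a b : ℕ) : b / a ≤ ⌈(b : ℚ) / (a : ℚ)⌉₊ := by
  rw [← Nat.floor_div_eq_div (K := ℚ)]
  exact Nat.floor_le_ceil _

theorem exists_isFPTAS_knapsack : ∃ K : Prog, IsFPTAS knapsack Set.univ K := by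
  have h₁' := polyTime_prepare.polyBdd
  obtain ⟨P₁, T₁, hT₁, h₁⟩ := polyTime_prepare
  obtain ⟨q, h₂⟩ := countUp_runs (α := (ℕ × List KItem) × ℕ)
  obtain ⟨P₃, T₃, ⟨q₃, hT₃⟩, h₃⟩ := polyTime_solve
  let μ : SchemeInput → ℕ := fun i => codeSize i + ⌈(i.1.2 : ℚ) / (i.1.1 : ℚ)⌉₊
  have hsize : PolyBdd μ fun i => codeSize i := PolyBdd.self.mono fun i => Nat.le_add_right _ _
  have hN : PolyBdd μ fun i => i.1.2 / i.1.1 + 1 := ((PolyBdd.self (μ := μ)).add (.const 1)).mono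
    fun i => Nat.succ_le_succ ((div_le_ceil _ _).trans (Nat.le_add_left _ _))
  have hn : PolyBdd μ fun i => i.2.2.length := hsize.mono fun i => by
    have := length_lt_codeSize i.2.2
    rw [codeSize_pair, codeSize_pair i.2]
    omega
  have hT₁ := hsize.trans hT₁
  have hT₂ := ((hn.mul (hn.mul hN)).add (hsize.trans h₁')).eval q
  have hT₃' := ((hsize.trans h₁').add hT₂).eval q₃
  -- 20 dominates every coefficient that results from applying `chain_runs` twice.
  have hT := ((((PolyBdd.const 20).mul hsize).add ((PolyBdd.const 20).mul hT₁)).add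
    (((PolyBdd.const 20).mul hT₂).add ((PolyBdd.const 20).mul hT₃'))).add (.const 20)
  obtain ⟨Q, hQ⟩ := hT
  refine ⟨chain (chain P₁ countUp) P₃, Q, fun I _ a b ha hab => ?_⟩
  let i : SchemeInput := ((a, b), I.cap, I.items)
  have hN0 : 0 < b / a + 1 := Nat.succ_pos _
  obtain ⟨hlen, hw, hopt⟩ := dpSolution_spec (R := List.range ((prepare i).1 + 1)) (c := I.cap)
    hN0 fun k hk => List.mem_range.2 (Nat.lt_succ_of_le hk)
  obtain ⟨t₁, hr₁, hle₁⟩ := h₁ i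
  obtain ⟨t₂, hr₂, hle₂⟩ := h₂ (prepare i).1 (prepare i).2
  obtain ⟨t₃, hr₃, hle₃⟩ := h₃ (List.range ((prepare i).1 + 1), (prepare i).2)
  have hsz := hr₂.size_le
  obtain ⟨t₄, hr₄, hle₄⟩ := chain_runs hr₁ hr₂
  obtain ⟨t₅, hr₅, hle₅⟩ := chain_runs hr₄ hr₃
  refine ⟨_, t₅, hr₅, ?_, ⟨hlen, hw⟩, ?_⟩
  · refine le_trans ?_ (hQ i)
    beta_reduce
    have e₂ : t₂ ≤ q.eval (i.2.2.length * (i.2.2.length * (i.1.2 / i.1.1 + 1)) +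
        codeSize (prepare i)) := by
      refine hle₂.trans (eval_mono q ?_)
      rw [codeSize_pair (prepare i)]
      change (prepare i).1 + _ ≤ (prepare i).1 + _
      omega
    have e₃ : t₃ ≤ q₃.eval (codeSize (prepare i) + q.eval (i.2.2.length *
        (i.2.2.length * (i.1.2 / i.1.1 + 1)) + codeSize (prepare i))) := by
      refine hle₃.trans ((hT₃ _).trans (eval_mono q₃ ?_))
      exact hsz.trans (Nat.add_le_add_left e₂ _)
    change t₄ ≤ 4 * codeSize i + _ + _ + _ at hle₄
    change t₅ ≤ 4 * codeSize i + _ + _ + _ at hle₅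
    omega
  · intro y hy
    have h := hopt y hy.1 hy.2
    change _ ≤ (selectedSum KItem.profit (dpSolution (List.range ((prepare i).1 + 1)) I.cap
      (I.items.length * (b / a + 1)) I.items) I.items : ℚ)
    change _ * (selectedSum KItem.profit y I.items : ℚ) ≤ _
    generalize selectedSum KItem.profit (dpSolution (List.range ((prepare i).1 + 1)) I.cap
      (I.items.length * (b / a + 1)) I.items) I.items = V at h ⊢
    generalize selectedSum KItem.profit y I.items = W at h ⊢
    -- Rounding `b / a` up in this way gives `1 / N ≤ a / b`.
    have hba : b ≤ a * (b / a + 1) := by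
      rw [Nat.mul_add, Nat.mul_one]
      exact (Nat.lt_mul_div_succ b ha).le
    generalize b / a + 1 = N at *
    have haQ : (0 : ℚ) < a := by exact_mod_cast ha
    have hbQ : (0 : ℚ) < b := by exact_mod_cast ha.trans hab
    have hNQ : (0 : ℚ) < N := by exact_mod_cast hN0
    have hQ' : (N : ℚ) * W ≤ N * V + W := by exact_mod_cast h
    have hε : 1 / (N : ℚ) ≤ a / b := by
      rw [div_le_div_iff₀ hNQ hbQ, one_mul]
      exact_mod_cast hba
    have : (1 - (a : ℚ) / b) * W ≤ (1 - 1 / N) * W :=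
      mul_le_mul_of_nonneg_right (by linarith) (Nat.cast_nonneg W)
    refine this.trans ?_
    have e : (1 - 1 / (N : ℚ)) * W = (N * W - W) / N := by field_simp
    rw [e, div_le_iff₀ hNQ]
    linarith

/-! ## Selected sums and maxima -/

theorem selectedSum_map {α β : Type} (g : α → β) (f : β → ℕ) (x : List Bool) (l : List α) :
    selectedSum f x (l.map g) = selectedSum (fun a => f (g a)) x l := by
  induction l generalizing x with
  | nil => cases x <;> simp [selectedSum]
  | cons a l ih => rcases x with - | ⟨_ | _, x⟩ <;> simp [selectedSum, ih]

theorem selectedMax_le {α : Type} {f : α → ℕ} {n : ℕ} (x : List Bool) (l : List α)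
    (h : ∀ a ∈ l, f a ≤ n) : selectedMax f x l ≤ n := by
  induction l generalizing x with
  | nil => cases x <;> simp [selectedMax]
  | cons a l ih =>
    have ih := fun x => ih x fun b hb => h b (by simp [hb])
    rcases x with - | ⟨_ | _, x⟩ <;> simp [selectedMax, ih, h]

/-- Each addition may create one carry bit, which is paid for by the nodes of the item's encoding.
-/
theorem codeSize_selectedSum_profit_le (x : List Bool) (l : List KItem) :
    codeSize (selectedSum KItem.profit x l) ≤ codeSize l := by
  induction l generalizing x with
  | nil => cases x <;> simp [selectedSum, codeSize_nat, codeSize_nil]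
  | cons a l ih =>
    rw [codeSize_cons]
    rcases x with - | ⟨_ | _, x⟩
    · simp [selectedSum, codeSize_nat]
    · exact (ih x).trans (by omega)
    · have h := ih x
      have h₁ := size_add_le a.profit (selectedSum KItem.profit x l)
      have h₂ : codeSize a = a.profit.size + 1 + (a.weight.size + 1) + 1 := rfl
      simp only [selectedSum, codeSize_nat] at h ⊢
      omega

/-! ### Rules for assignments and calls with the value named explicitly. -/

namespace Ends

variable {S T : ℕ} {s : Store} {Q : Store → Prop} {i : ℕ} {e : Expr} {v : Val}

theorem assign_eq (hs : s.Bdd S) (he : e.eval s = v) (h : Q (Function.update s i v)) :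
    Ends S T (.assign i e) s Q := assign hs (he ▸ h)

theorem assign_seq_eq {P : Prog} (hs : s.Bdd S) (he : e.eval s = v) (hv : v.size ≤ S)
    (h : Store.Bdd S (Function.update s i v) → Ends S T P (Function.update s i v) Q) :
    Ends S T (.seq (.assign i e) P) s Q := assign_seq hs (he ▸ h (hs.update hv))

theorem call_seq_eq {P P' : Prog} {r : Val} {t : ℕ} (hs : s.Bdd S) (he : e.eval s = v)
    (hr : Runs P v r t) (ht : t ≤ T) (hrS : r.size ≤ S)
    (h : Store.Bdd S (Function.update s i r) → Ends S T P' (Function.update s i r) Q) :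
    Ends S T (.seq (.call i P e) P') s Q :=
  seq (call hs (he ▸ hr) ht hrS (h (hs.update hrS)))

end Ends

/-! ## The approximation algorithm -/

theorem packedProfit_runs : ∃ q : Polynomial ℕ, ∀ (x : List Bool) (l : List KItem),
    x.length = l.length → ∃ t, Runs packedProfit (code (x, l))
      (.num (selectedSum KItem.profit x l)) t ∧ t ≤ q.eval (codeSize (x, l)) := by
  let body : Prog :=
    .seq (.ite (.fst (.var 1)) (.assign 0 (.bin .add (.var 0) (.fst (.fst (.var 2))))) .skip) <|
    .seq (.assign 1 (.snd (.var 1))) <| .assign 2 (.snd (.var 2))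
  let μ : ℕ → ℕ := fun i => i
  have hS : PolyBdd μ fun i => i := PolyBdd.self
  have hT := hS.mul (((hS.expr (.var 1)).add (hS.prog (.const 0) body)).add (.const 1))
  obtain ⟨q, hq⟩ := hS.prog hT packedProfit
  refine ⟨q, fun x l hxl => ?_⟩
  have hq := hq (codeSize (x, l))
  suffices h : ∃ t, Runs packedProfit (code (x, l)) (.num (selectedSum KItem.profit x l)) t ∧
      t ≤ packedProfit.bound (codeSize (x, l)) _ by
    obtain ⟨t, ht, hle⟩ := h
    exact ⟨t, ht, hle.trans hq⟩
  have hsize : codeSize (x, l) = codeSize x + codeSize l + 1 := rfl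
  set S := codeSize (x, l) with hSdef
  have hs : Store.Bdd S (Store.init (code (x, l))) := Store.Bdd.init le_rfl
  have hx : (code x).size ≤ S := by change codeSize x ≤ S; omega
  have hl : (code l).size ≤ S := by change codeSize l ≤ S; omega
  -- Partial sums never exceed the final sum, which is no larger than the input.
  have hsum : ∀ n ≤ selectedSum KItem.profit x l, (Val.num n).size ≤ S := fun n hn => by
    have h₁ := codeSize_selectedSum_profit_le x l
    have h₂ : codeSize n ≤ codeSize (selectedSum KItem.profit x l) :=
      Nat.succ_le_succ (Nat.size_le_size hn)
    change codeSize n ≤ S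
    omega
  refine Ends.runs ?_
  refine Ends.assign_seq_eq hs (v := code x) (by simp [Expr.eval, Store.init, code_pair, Val.fst])
    hx fun hs => ?_
  refine Ends.assign_seq_eq hs (v := code l) (by simp [Expr.eval, Store.init, code_pair, Val.snd])
    hl fun hs => ?_
  refine Ends.assign_seq_eq hs (v := .num 0) rfl (hsum 0 (Nat.zero_le _)) fun hs => ?_
  refine Ends.while_loop (S := S) (T := 0) (n := x.length) (I := fun n s => s.Bdd S ∧
    ∃ x' l', x'.length = n ∧ l'.length = n ∧ s 1 = code x' ∧ s 2 = code l' ∧ codeSize x' ≤ S ∧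
      codeSize l' ≤ S ∧ ∃ v, s 0 = .num v ∧
        v + selectedSum KItem.profit x' l' = selectedSum KItem.profit x l)
    (fun k s hI => hI.1) ?_ ?_ ?_ ?_ ?_
  · rintro s ⟨-, x', l', hx', -, h1, -⟩
    obtain rfl := List.length_eq_zero_iff.1 hx'
    simp [Expr.eval, h1, code_nil]
  · rintro n s ⟨hb, x', l', hx', hl', h1, h2, hx'S, hl'S, v, h0, hv⟩
    obtain ⟨b, x', rfl⟩ := List.exists_cons_of_length_eq_add_one hx'
    obtain ⟨a, l', rfl⟩ := List.exists_cons_of_length_eq_add_one hl'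
    rw [codeSize_cons] at hx'S hl'S
    have hx''S : codeSize x' ≤ S := by omega
    have hl''S : codeSize l' ≤ S := by omega
    refine ⟨by simp [Expr.eval, h1, code_cons], Ends.seq ?_⟩
    have rest : ∀ (s' : Store) (v' : ℕ), s'.Bdd S → s' 0 = .num v' → s' 1 = s 1 → s' 2 = s 2 →
        v' + selectedSum KItem.profit x' l' = selectedSum KItem.profit x l →
        Ends S 0 (.seq (.assign 1 (.snd (.var 1))) <| .assign 2 (.snd (.var 2))) s'
          fun s => s.Bdd S ∧
    ∃ x' l', x'.length = n ∧ l'.length = n ∧ s 1 = code x' ∧ s 2 = code l' ∧ codeSize x' ≤ S ∧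
      codeSize l' ≤ S ∧ ∃ v, s 0 = .num v ∧
        v + selectedSum KItem.profit x' l' = selectedSum KItem.profit x l := by
      intro s' v' hb' h0' h1' h2' hv'
      refine Ends.assign_seq_eq hb' (v := code x')
        (by simp [Expr.eval, h1', h1, code_cons, Val.snd]) hx''S fun hb' => ?_
      refine Ends.assign_eq hb' (v := code l')
        (by simp [Expr.eval, h2', h2, code_cons, Val.snd]) ⟨hb'.update hl''S, x', l',
          by simpa using hx', by simpa using hl', by simp, by simp, hx''S, hl''S, v',
          by simpa using h0', hv'⟩
    refine Ends.ite hb (fun hne => ?_) (fun he => ?_)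
    · have hbt : b = true := by
        cases b
        · simp [Expr.eval, h1, code_cons, Val.fst, code_bool] at hne
        · rfl
      subst hbt
      simp only [selectedSum] at hv
      refine Ends.assign_eq hb (v := .num (v + a.profit)) ?_ ?_
      · simp [Expr.eval, Op.eval, h0, h2, code_cons, Val.fst, Val.toNat, code_kitem]
      · exact rest _ (v + a.profit) (hb.update (hsum _ (by omega))) (by simp) (by simp) (by simp)
          (by omega)
    · have hbt : b = false := by
        cases b
        · rfl
        · simp [Expr.eval, h1, code_cons, Val.fst, code_bool] at he
      subst hbt
      simp only [selectedSum] at hv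
      exact Ends.skip (rest s v hb h0 rfl rfl hv)
  · exact ⟨hs, x, l, rfl, hxl.symm, by simp, by simp, hx, hl, 0, by simp, by simp⟩
  · refine Nat.mul_le_mul_right _ ?_
    have := length_lt_codeSize x
    omega
  · rintro s ⟨-, x', l', hx', -, -, -, -, -, v, h0, hv⟩
    obtain rfl := List.length_eq_zero_iff.1 hx'
    simp only [selectedSum, Nat.add_zero] at hv
    rw [h0, hv]

/-- `x` is a feasible vector of value `v` for the items `l` and the capacity `c`, and `v` is at
least `θ` times the value of every feasible vector. -/
def IsApprox (θ : ℚ) (c : ℕ) (l : List Item) (x : List Bool) (v : ℕ) : Prop :=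
  x.length = l.length ∧ selectedSum (fun i : Item => i.weight) x l ≤ c ∧
    (selectedSum (fun i : Item => i.profit) x l : ℤ) - selectedMax Item.penalty x l = v ∧
    ∀ y : List Bool, y.length = l.length → selectedSum (fun i : Item => i.weight) y l ≤ c →
      θ * (((selectedSum (fun i : Item => i.profit) y l : ℤ) -
        selectedMax Item.penalty y l : ℤ) : ℚ) ≤ v

namespace IsApprox

variable {θ : ℚ} {c : ℕ} {i : Item} {l : List Item} {x : List Bool} {v : ℕ}

theorem nil : IsApprox θ c [] [] 0 := by
  refine ⟨rfl, Nat.zero_le _, by simp [selectedSum, selectedMax], fun y hy _ => ?_⟩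
  obtain rfl := List.length_eq_zero_iff.1 hy
  simp [selectedSum, selectedMax]

/-- The approximate solution for `i :: l` that does not select `i`. -/
theorem cons_false (h : IsApprox θ c l x v) (hi : ∀ j ∈ l, j.penalty ≤ i.penalty)
    (hv : ∀ y : List Bool, y.length = l.length →
      i.weight + selectedSum (fun i : Item => i.weight) y l ≤ c →
      θ * ((i.profit : ℚ) + selectedSum (fun i : Item => i.profit) y l - i.penalty) ≤ v) :
    IsApprox θ c (i :: l) (false :: x) v := by
  obtain ⟨h₁, h₂, h₃, h₄⟩ := h
  refine ⟨by simp [h₁], by simpa [selectedSum] using h₂,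
    by simpa [selectedSum, selectedMax] using h₃, fun y hy hyc => ?_⟩
  obtain ⟨b, y, rfl⟩ := List.exists_cons_of_length_eq_add_one hy
  have hy' : y.length = l.length := by simpa using hy
  cases b with
  | false => exact h₄ y hy' hyc
  | true =>
    have := hv y hy' hyc
    -- The leading item has the greatest penalty, so the maximum is known whatever `y` selects.
    simp only [selectedSum, selectedMax, max_eq_left (selectedMax_le y l hi)]
    push_cast
    exact this

/-- The approximate solution for `i :: l` that selects `i`. -/
theorem cons_true {z : List Bool} {v' : ℕ} (h : IsApprox θ c l x v)
    (hi : ∀ j ∈ l, j.penalty ≤ i.penalty) (hz : z.length = l.length)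
    (hzc : i.weight + selectedSum (fun i : Item => i.weight) z l ≤ c) (hvv' : v ≤ v')
    (hv' : i.profit + selectedSum (fun i : Item => i.profit) z l = v' + i.penalty)
    (hv : ∀ y : List Bool, y.length = l.length →
      i.weight + selectedSum (fun i : Item => i.weight) y l ≤ c →
      θ * ((i.profit : ℚ) + selectedSum (fun i : Item => i.profit) y l - i.penalty) ≤ v') :
    IsApprox θ c (i :: l) (true :: z) v' := by
  obtain ⟨h₁, h₂, h₃, h₄⟩ := h
  refine ⟨by simp [hz], by simpa [selectedSum] using hzc, ?_, fun y hy hyc => ?_⟩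
  · simp only [selectedSum, selectedMax, max_eq_left (selectedMax_le z l hi)]
    omega
  obtain ⟨b, y, rfl⟩ := List.exists_cons_of_length_eq_add_one hy
  have hy' : y.length = l.length := by simpa using hy
  cases b with
  | false => exact (h₄ y hy' hyc).trans (by exact_mod_cast hvv')
  | true =>
    have := hv y hy' hyc
    simp only [selectedSum, selectedMax, max_eq_left (selectedMax_le y l hi)]
    push_cast
    exact this

end IsApprox

/-- The key estimate: if a penalty `π` satisfies `π + 1 ≤ C`, then a knapsack solution of
accuracy `ε / C` for the items after the leading one has accuracy `ε` for the penalized value. -/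
theorem penalized_le {ε C p P P' π : ℚ} {v : ℕ} (hε₀ : 0 ≤ ε) (hε₁ : ε ≤ 1) (hC : 0 < C)
    (hp : 0 ≤ p) (hint : ∃ V : ℤ, p + P - π = V) (hπ : π + 1 ≤ C) (hπ₀ : 0 ≤ π)
    (hP : (1 - ε / C) * P ≤ P') (hv : p + P' - π ≤ v) : (1 - ε) * (p + P - π) ≤ v := by
  obtain ⟨V, hV⟩ := hint
  rw [hV]
  rcases le_or_gt V 0 with h | h
  · have : (V : ℚ) ≤ 0 := by exact_mod_cast h
    exact (mul_nonpos_of_nonneg_of_nonpos (by linarith) this).trans (Nat.cast_nonneg v)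
  · have hV1 : (1 : ℚ) ≤ V := by exact_mod_cast h
    -- `P ≤ V + π` since `p ≥ 0`, then `π ≤ π * V` since `V ≥ 1`, and `1 + π ≤ C`.
    have hPV : P ≤ C * V := by nlinarith
    have : ε / C * P ≤ ε / C * (C * V) := mul_le_mul_of_nonneg_left hPV (by positivity)
    have e : ε / C * (C * V) = ε * V := by field_simp
    nlinarith

/-! ### Sizes of the values that `algorithmA` holds in memory. -/

theorem codeSize_append {α : Type} [Code α] (l l' : List α) :
    codeSize (l ++ l') + 1 = codeSize l + codeSize l' := by
  induction l with
  | nil => rw [codeSize_nil, List.nil_append, Nat.add_comm]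
  | cons a l ih => rw [List.cons_append, codeSize_cons, codeSize_cons]; omega

theorem codeSize_reverse {α : Type} [Code α] (l : List α) : codeSize l.reverse = codeSize l := by
  induction l with
  | nil => rfl
  | cons a l ih =>
    have h := codeSize_append l.reverse [a]
    rw [codeSize_cons, codeSize_nil] at h
    rw [List.reverse_cons, codeSize_cons]
    omega

/-- The input of `algorithmA`. -/
abbrev penalizedInput (a b : ℕ) (I : Inst) :
    (ℕ × ℕ) × ℕ × List KItem × List ℕ :=
  ((a, b), I.cap, I.items.map Item.toKItem, I.items.map Item.penalty)

theorem schemeInput_penalized (a b : ℕ) (I : Inst) :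
    schemeInput a b (penalizedKnapsack.encode I) = code (penalizedInput a b I) := by
  simp only [schemeInput, penalizedKnapsack, code, List.map_map]
  rfl

/-- The members of the stack that `algorithmA` uses. -/
def stackItem (i : Item) : KItem × ℕ := (i.toKItem, i.penalty)

theorem codeSize_map_stackItem (l : List Item) : codeSize (l.map stackItem) + 1 =
    codeSize (l.map Item.toKItem) + codeSize (l.map Item.penalty) := by
  induction l with
  | nil => rfl
  | cons i l ih =>
    simp only [List.map_cons, codeSize_cons, codeSize_pair]
    simp only [stackItem]
    omega

theorem codeSize_stack_le {l l' : List Item} (a b : ℕ) (I : Inst) (h : I.items = l ++ l') :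
    codeSize (l.reverse.map stackItem) ≤ codeSize (penalizedInput a b I) := by
  have h₁ := codeSize_append (l.map stackItem) (l'.map stackItem)
  have h₂ := codeSize_pos (l'.map stackItem)
  have h₃ := codeSize_map_stackItem (l ++ l')
  rw [List.map_append] at h₃
  rw [List.map_reverse, codeSize_reverse]
  simp only [penalizedInput, codeSize_pair, h]
  omega

theorem codeSize_suffix_le {l l' : List Item} (a b : ℕ) (I : Inst) (h : I.items = l ++ l') :
    codeSize (a, b) + codeSize I.cap + codeSize (l'.map Item.toKItem) + 2 ≤
      codeSize (penalizedInput a b I) := by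
  have h₁ : codeSize (l'.map Item.toKItem) ≤ codeSize (I.items.map Item.toKItem) :=
    codeSize_le_of_suffix ⟨l.map Item.toKItem, by rw [h, List.map_append]⟩
  simp only [penalizedInput, codeSize_pair]
  omega

/-- The factor 3 is 2 for a bit and 1 for its pair node. -/
theorem codeSize_vector_le {x : List Bool} {l l' : List Item} (a b : ℕ) (I : Inst)
    (h : I.items = l ++ l') (hx : x.length = l'.length) :
    codeSize x ≤ 3 * codeSize (penalizedInput a b I) := by
  have h₁ := codeSize_suffix_le a b I h
  have h₂ := length_lt_codeSize (l'.map Item.toKItem)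
  have h₃ : codeSize x ≤ x.length * (2 + 1) + 1 := codeSize_list_le fun b _ => codeSize_bool_le b
  rw [List.length_map] at h₂
  omega

/-! ### The two loops of `algorithmA` and their invariants. -/

open _root_.PKP.Expr _root_.PKP.Prog in
/-- The body of the first loop of `algorithmA`. -/
def stackBody : Prog :=
  seq (assign 5 (bin .pair (bin .pair (fst (var 3)) (fst (var 4))) (var 5))) <|
  seq (assign 3 (snd (var 3))) <|
  assign 4 (snd (var 4))

open _root_.PKP.Expr _root_.PKP.Prog in
/-- The body of the second loop of `algorithmA`. -/
def scanBody (K : Prog) : Prog :=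
  seq (assign 9 (fst (var 5))) <|
  seq (assign 5 (snd (var 5))) <|
  seq (ite (bin .sub (snd (fst (var 9))) (var 2))
    (assign 7 (bin .pair (num 0) (var 7)))
    (seq (call 10 K
        (bin .pair (var 1) (bin .pair (bin .sub (var 2) (snd (fst (var 9)))) (var 6)))) <|
      seq (call 11 packedProfit (bin .pair (var 10) (var 6))) <|
      seq (assign 11 (bin .sub (bin .add (fst (fst (var 9))) (var 11)) (snd (var 9)))) <|
      ite (bin .sub (var 11) (var 8))
        (seq (assign 7 (bin .pair (num 1) (var 10))) (assign 8 (var 11)))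
        (assign 7 (bin .pair (num 0) (var 7))))) <|
  assign 6 (bin .pair (fst (var 9)) (var 6))

/-- Invariant of the first loop of `algorithmA`, with `n` iterations left. -/
def StackInv (S a b : ℕ) (I : Inst) (n : ℕ) (s : Store) : Prop :=
  s.Bdd S ∧ ∃ l₁ l₂, I.items = l₁ ++ l₂ ∧ l₂.length = n ∧ s 1 = code (a, b) ∧ s 2 = code I.cap ∧
    s 3 = code (l₂.map Item.toKItem) ∧ s 4 = code (l₂.map Item.penalty) ∧
    s 5 = code (l₁.reverse.map stackItem)

/-- Invariant of the second loop of `algorithmA`, with `n` iterations left. -/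
def ScanInv (S a b : ℕ) (θ : ℚ) (I : Inst) (n : ℕ) (s : Store) : Prop :=
  s.Bdd S ∧ ∃ l₁ l₂, I.items = l₁ ++ l₂ ∧ l₁.length = n ∧ s 1 = code (a, b) ∧ s 2 = code I.cap ∧
    s 5 = code (l₁.reverse.map stackItem) ∧ s 6 = code (l₂.map Item.toKItem) ∧
    ∃ x v, s 7 = code x ∧ s 8 = code v ∧ IsApprox θ I.cap l₂ x v

theorem stackBody_ends {S T a b n : ℕ} {I : Inst} {s : Store}
    (hS : codeSize (penalizedInput a b I) ≤ S) (h : StackInv S a b I (n + 1) s) :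
    Ends S T stackBody s (StackInv S a b I n) := by
  obtain ⟨hb, l₁, l₂, hI, hn, h1, h2, h3, h4, h5⟩ := h
  obtain ⟨i, l₂, rfl⟩ := List.exists_cons_of_length_eq_add_one hn
  have hI' : I.items = (l₁ ++ [i]) ++ l₂ := by simp [hI]
  have hs₃ : codeSize (l₂.map Item.toKItem) ≤ S := by
    have := codeSize_suffix_le a b I hI'; omega
  have hs₄ : codeSize (l₂.map Item.penalty) ≤ S := by
    have h₁ : codeSize (l₂.map Item.penalty) ≤ codeSize (I.items.map Item.penalty) :=
      codeSize_le_of_suffix ⟨(l₁ ++ [i]).map Item.penalty, by rw [hI', List.map_append (l₁ := l₁ ++ [i])]⟩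
    simp only [penalizedInput, codeSize_pair] at hS
    omega
  refine Ends.assign_seq_eq hb (v := code ((l₁ ++ [i]).reverse.map stackItem)) ?_
    ((codeSize_stack_le a b I hI').trans hS) fun hb => ?_
  · simp [Expr.eval, Op.eval, h3, h4, h5, code_cons, stackItem, code_pair, Val.fst]
  refine Ends.assign_seq_eq hb (v := code (l₂.map Item.toKItem)) ?_ hs₃ fun hb => ?_
  · simp [Expr.eval, h3, code_cons, Val.snd]
  refine Ends.assign_eq hb (v := code (l₂.map Item.penalty)) ?_ ?_
  · simp [Expr.eval, h4, code_cons, Val.snd]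
  exact ⟨hb.update hs₄, l₁ ++ [i], l₂, hI', by simpa using hn, by simpa using h1,
    by simpa using h2, by simp, by simp, by simp⟩

/-- `K` is only run on a suffix of the items with a smaller or equal capacity, so its inputs are no
larger than the whole input and one `T` serves all iterations. The outcome extends the invariant by
`IsApprox.cons_true` if the new solution wins, and by `IsApprox.cons_false` otherwise. -/
theorem scanBody_ends {K : Prog} {S T a b n : ℕ} {ε C : ℚ} {I : Inst} {s : Store}
    {q : Polynomial ℕ} (hS : 4 * codeSize (penalizedInput a b I) ≤ S)
    (hq : ∀ (x : List Bool) (l : List KItem), x.length = l.length →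
      ∃ t, Runs packedProfit (code (x, l)) (.num (selectedSum KItem.profit x l)) t ∧
        t ≤ q.eval (codeSize (x, l)))
    (hT : q.eval (S + 1) ≤ T)
    (hK : ∀ (l : List KItem) (c : ℕ),
      codeSize ((a, b), c, l) ≤ codeSize (penalizedInput a b I) →
      ∃ z t, Runs K (code ((a, b), c, l)) (code z) t ∧ t ≤ T ∧ z.length = l.length ∧
        selectedSum KItem.weight z l ≤ c ∧ ∀ y : List Bool, y.length = l.length →
          selectedSum KItem.weight y l ≤ c →
          (1 - ε / C) * (selectedSum KItem.profit y l : ℚ) ≤ selectedSum KItem.profit z l)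
    (hε₀ : 0 ≤ ε) (hε₁ : ε ≤ 1) (hC : 0 < C) (hpen : ∀ i ∈ I.items, (i.penalty : ℚ) + 1 ≤ C)
    (h : ScanInv S a b (1 - ε) I (n + 1) s) :
    Ends S T (scanBody K) s (ScanInv S a b (1 - ε) I n) := by
  obtain ⟨hb, l₁', l₂, hI, hn, h1, h2, h5, h6, x, v, h7, h8, hx⟩ := h
  obtain ⟨l₁, i, rfl⟩ : ∃ l₁ i, l₁' = l₁ ++ [i] := by
    rcases List.eq_nil_or_concat l₁' with rfl | ⟨l, i, rfl⟩
    · simp at hn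
    · exact ⟨l, i, by simp⟩
  have hI' : I.items = l₁ ++ (i :: l₂) := by simp [hI]
  have hpeni : (i.penalty : ℚ) + 1 ≤ C := hpen i (by simp [hI'])
  have hsort : ∀ j ∈ l₂, j.penalty ≤ i.penalty := by
    have := I.sorted
    rw [hI', List.pairwise_append, List.pairwise_cons] at this
    exact this.2.1.1
  have hs₅ := codeSize_stack_le a b I hI
  have hs₅' : codeSize (l₁.reverse.map stackItem) ≤ S := by
    have := codeSize_stack_le a b I hI'; omega
  have hs₆ := codeSize_suffix_le a b I hI
  have hs₆' := codeSize_suffix_le a b I hI'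
  have hvec : ∀ z : List Bool, z.length = l₂.length → codeSize z ≤ S := fun z hz => by
    have := codeSize_vector_le a b I hI hz; omega
  have hvec' : ∀ z : List Bool, z.length = (i :: l₂).length → codeSize z ≤ S := fun z hz => by
    have := codeSize_vector_le a b I hI' hz; omega
  have hs₉ : codeSize (stackItem i) ≤ S := by
    have : codeSize (stackItem i) ≤ codeSize ((l₁ ++ [i]).reverse.map stackItem) :=
      codeSize_le_of_mem (by simp)
    omega
  have e5 : s 5 = .pair (code (stackItem i)) (code (l₁.reverse.map stackItem)) := by
    rw [h5]; simp [code_cons]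
  refine Ends.assign_seq_eq hb (v := code (stackItem i)) (by simp [Expr.eval, e5, Val.fst]) hs₉
    fun hb => ?_
  refine Ends.assign_seq_eq hb (v := code (l₁.reverse.map stackItem))
    (by simp [Expr.eval, e5, Val.snd]) hs₅' fun hb => ?_
  -- the last command
  have last : ∀ (s' : Store) (x' : List Bool) (v' : ℕ), s'.Bdd S → s' 1 = code (a, b) →
      s' 2 = code I.cap → s' 5 = code (l₁.reverse.map stackItem) →
      s' 6 = code (l₂.map Item.toKItem) → s' 7 = code x' → s' 8 = code v' →
      s' 9 = code (stackItem i) → IsApprox (1 - ε) I.cap (i :: l₂) x' v' →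
      Ends S T (.assign 6 (.bin .pair (.fst (.var 9)) (.var 6))) s'
        (ScanInv S a b (1 - ε) I n) := by
    intro s' x' v' hb' h1' h2' h5' h6' h7' h8' h9' hx'
    refine Ends.assign_eq hb' (v := code ((i :: l₂).map Item.toKItem)) ?_
      ⟨hb'.update (by change codeSize ((i :: l₂).map Item.toKItem) ≤ S; omega), l₁, i :: l₂, hI',
        by simpa using hn, by simpa using h1', by simpa using h2', by simpa using h5', by simp,
        x', v', by simpa using h7', by simpa using h8', hx'⟩
    simp [Expr.eval, Op.eval, h6', h9', stackItem, code_pair, code_cons, Val.fst]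
  set s₁ := Function.update (Function.update s 9 (code (stackItem i))) 5
    (code (l₁.reverse.map stackItem)) with hs₁
  have g1 : s₁ 1 = code (a, b) := by simp [hs₁, h1]
  have g2 : s₁ 2 = code I.cap := by simp [hs₁, h2]
  have g5 : s₁ 5 = code (l₁.reverse.map stackItem) := by simp [hs₁]
  have g6 : s₁ 6 = code (l₂.map Item.toKItem) := by simp [hs₁, h6]
  have g7 : s₁ 7 = code x := by simp [hs₁, h7]
  have g8 : s₁ 8 = code v := by simp [hs₁, h8]
  have g9 : s₁ 9 = code (stackItem i) := by simp [hs₁]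
  clear_value s₁
  refine Ends.seq (Ends.ite hb (fun hne => ?_) (fun he => ?_))
  · have hw : I.cap < i.weight := by
      simpa [Expr.eval, Op.eval, g9, g2, stackItem, code_pair, code_kitem, code_nat, Val.fst,
        Val.snd, Val.toNat, Nat.sub_eq_zero_iff_le] using hne
    refine Ends.assign_eq hb (v := code (false :: x))
      (by simp [Expr.eval, Op.eval, g7, code_cons, code_bool]) ?_
    refine last _ (false :: x) v (hb.update (hvec' _ (by simp [hx.1]))) (by simpa using g1)
      (by simpa using g2) (by simpa using g5) (by simpa using g6) (by simp) (by simpa using g8)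
      (by simpa using g9) (hx.cons_false hsort fun y _ hy => ?_)
    omega
  · have hw : i.weight ≤ I.cap := by
      simpa [Expr.eval, Op.eval, g9, g2, stackItem, code_pair, code_kitem, code_nat, Val.fst,
        Val.snd, Val.toNat, Nat.sub_eq_zero_iff_le] using he
    obtain ⟨z, t, hz, ht, hzl, hzw, hzopt⟩ := hK (l₂.map Item.toKItem) (I.cap - i.weight) (by
      have : codeSize (I.cap - i.weight) ≤ codeSize I.cap :=
        Nat.succ_le_succ (Nat.size_le_size (Nat.sub_le _ _))
      rw [codeSize_pair, codeSize_pair (_, l₂.map Item.toKItem)]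
      simp only
      omega)
    obtain ⟨t', hP, ht'⟩ := hq z (l₂.map Item.toKItem) hzl
    have hzl' : z.length = l₂.length := by simpa using hzl
    have hsz := codeSize_vector_le a b I hI hzl'
    have hsum := codeSize_selectedSum_profit_le z (l₂.map Item.toKItem)
    have hnew := codeSize_selectedSum_profit_le (true :: z) ((i :: l₂).map Item.toKItem)
    simp only [List.map_cons, selectedSum] at hnew
    set V := selectedSum KItem.profit z (l₂.map Item.toKItem) with hV
    have hnew' : codeSize (i.profit + V - i.penalty) ≤ codeSize (i.profit + V) :=
      Nat.succ_le_succ (Nat.size_le_size (Nat.sub_le _ _))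
    simp only [List.map_cons] at hs₆'
    refine Ends.call_seq_eq hb (v := code ((a, b), I.cap - i.weight, l₂.map Item.toKItem))
      ?_ hz ht (hvec z hzl') fun hb => ?_
    · simp [Expr.eval, Op.eval, g1, g2, g6, g9, stackItem, code_pair, code_kitem, code_nat,
        Val.fst, Val.snd, Val.toNat]
    refine Ends.call_seq_eq hb (v := code (z, l₂.map Item.toKItem)) ?_ hP ?_ ?_ fun hb => ?_
    · simp [Expr.eval, Op.eval, g6, code_pair]
    · refine ht'.trans (le_trans (eval_mono q ?_) hT)
      rw [codeSize_pair]
      simp only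
      omega
    · change codeSize V ≤ S
      omega
    refine Ends.assign_seq_eq hb (v := code (i.profit + V - i.penalty)) ?_ ?_ fun hb => ?_
    · simp [Expr.eval, Op.eval, g9, stackItem, code_pair, code_kitem, code_nat, Val.fst, Val.snd,
        Val.toNat]
    · change codeSize (i.profit + V - i.penalty) ≤ S
      omega
    -- the estimate for the vectors that select the item
    have hest : ∀ v' : ℕ, i.profit + V - i.penalty ≤ v' → ∀ y : List Bool,
        y.length = l₂.length →
        i.weight + selectedSum (fun i : Item => i.weight) y l₂ ≤ I.cap →
        (1 - ε) * ((i.profit : ℚ) + selectedSum (fun i : Item => i.profit) y l₂ - i.penalty) ≤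
          v' := by
      intro v' hv' y hy hyw
      have := hzopt y (by simpa using hy) (by rw [selectedSum_map]; omega)
      rw [selectedSum_map Item.toKItem KItem.profit y] at this
      refine penalized_le hε₀ hε₁ hC (Nat.cast_nonneg _) ⟨(i.profit : ℤ) +
        selectedSum (fun i : Item => i.profit) y l₂ - i.penalty, by push_cast; rfl⟩ hpeni
        (Nat.cast_nonneg _) this ?_
      have : i.profit + V ≤ v' + i.penalty := by omega
      have : (i.profit : ℚ) + V ≤ v' + i.penalty := by exact_mod_cast this
      linarith
    -- A negative value is truncated to 0 and so never beats `v`.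
    refine Ends.ite hb (fun hne => ?_) (fun he => ?_)
    · have hlt : v < i.profit + V - i.penalty := by
        have : ¬ (i.profit + V - i.penalty ≤ v) := by
          simpa [Expr.eval, Op.eval, g8, code_nat, Val.toNat, Nat.sub_eq_zero_iff_le] using hne
        omega
      refine Ends.assign_seq_eq hb (v := code (true :: z))
        (by simp [Expr.eval, Op.eval, code_cons, code_bool]) (hvec' _ (by simp [hzl']))
        fun hb => ?_
      refine Ends.assign_eq hb (v := code (i.profit + V - i.penalty)) (by simp [Expr.eval]) ?_
      refine last _ (true :: z) (i.profit + V - i.penalty)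
        (hb.update (by change codeSize (i.profit + V - i.penalty) ≤ S; omega))
        (by simpa using g1) (by simpa using g2) (by simpa using g5) (by simpa using g6) (by simp)
        (by simp) (by simpa using g9)
        (hx.cons_true hsort hzl' ?_ hlt.le ?_ (hest _ le_rfl))
      · rw [selectedSum_map] at hzw
        omega
      -- By `hlt` the truncated difference is positive, hence exact.
      · rw [hV, selectedSum_map] at hlt ⊢
        omega
    · have hle : i.profit + V - i.penalty ≤ v := by
        simpa [Expr.eval, Op.eval, g8, code_nat, Val.toNat, Nat.sub_eq_zero_iff_le] using he
      refine Ends.assign_eq hb (v := code (false :: x))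
        (by simp [Expr.eval, Op.eval, g7, code_cons, code_bool]) ?_
      exact last _ (false :: x) v (hb.update (hvec' _ (by simp [hx.1]))) (by simpa using g1)
        (by simpa using g2) (by simpa using g5) (by simpa using g6) (by simp) (by simpa using g8)
        (by simpa using g9) (hx.cons_false hsort (hest v hle))

/-- The accuracy need be a legitimate one only if there are items, since otherwise `K` is never
called. This covers `C < 1`, where `ε / C` may be 1 or more but the bounded class has only instances
without items. -/
theorem algorithmA_runs {K : Prog} (hK : IsFPTAS knapsack Set.univ K) : ∃ Q : Polynomial ℕ,
    ∀ (a b : ℕ) (I : Inst) (ε C : ℚ), (I.items ≠ [] → 0 < a ∧ a < b) →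
      (a : ℚ) / (b : ℚ) = ε / C → 0 ≤ ε → ε ≤ 1 → 0 < C →
      (∀ i ∈ I.items, (i.penalty : ℚ) + 1 ≤ C) →
      ∃ x v t, Runs (algorithmA K) (code (penalizedInput a b I)) (code x) t ∧
        t ≤ Q.eval (codeSize (penalizedInput a b I) + ⌈(b : ℚ) / (a : ℚ)⌉₊) ∧
        IsApprox (1 - ε) I.cap I.items x v := by
  obtain ⟨qK, hK⟩ := hK
  obtain ⟨q, hq⟩ := packedProfit_runs
  let N : ℕ × ℕ × Inst → ℕ := fun i => codeSize (penalizedInput i.1 i.2.1 i.2.2)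
  let μ : ℕ × ℕ × Inst → ℕ := fun i => N i + ⌈(i.2.1 : ℚ) / (i.1 : ℚ)⌉₊
  have hN : PolyBdd μ N := PolyBdd.self.mono fun i => Nat.le_add_right _ _
  -- Three parts hold a 0-1 vector; the fourth makes the pair of a vector and an item list, passed
  -- to `packedProfit`, fit into `S + 1`.
  have hS := (PolyBdd.const 4).mul hN
  have hT₁ := ((PolyBdd.self (μ := μ)).eval qK).add ((hS.add (.const 1)).eval q)
  have hW₁ := hN.mul (((hS.expr (.var 3)).add (hS.prog (.const 0) stackBody)).add (.const 1))
  have hW₂ := hN.mul (((hS.expr (.var 5)).add (hS.prog hT₁ (scanBody K))).add (.const 1))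
  obtain ⟨Q, hQ⟩ := hS.prog (hW₁.add hW₂) (algorithmA K)
  refine ⟨Q, fun a b I ε C hab hεC hε₀ hε₁ hC hpen => ?_⟩
  have hQ := hQ (a, b, I)
  suffices h : ∃ x v, IsApprox (1 - ε) I.cap I.items x v ∧
      ∃ t, Runs (algorithmA K) (code (penalizedInput a b I)) (code x) t ∧
        t ≤ (algorithmA K).bound (4 * N (a, b, I)) _ by
    obtain ⟨x, v, hx, t, ht, hle⟩ := h
    exact ⟨x, v, t, ht, hle.trans hQ, hx⟩
  have hpos : 0 < N (a, b, I) := codeSize_pos _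
  clear hQ hW₁ hW₂ hT₁ hS hN
  have hlen : I.items.length + 1 ≤ N (a, b, I) := by
    have h₁ := length_lt_codeSize (I.items.map Item.toKItem)
    have h₂ := codeSize_suffix_le a b I (l := []) (l' := I.items) rfl
    rw [List.length_map] at h₁
    simp only [N]
    omega
  set S := 4 * N (a, b, I) with hSdef
  -- Of the total `T`, only that it dominates both loops is kept.
  suffices h : ∀ T, (N (a, b, I) * ((Expr.var 3).bound S + stackBody.bound S 0 + 1) ≤ T) →
      N (a, b, I) * ((Expr.var 5).bound S + (scanBody K).bound S
        (qK.eval (μ (a, b, I)) + q.eval (S + 1)) + 1) ≤ T →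
      Ends S T (algorithmA K) (Store.init (code (penalizedInput a b I))) fun s =>
        ∃ x v, IsApprox (1 - ε) I.cap I.items x v ∧ s 0 = code x by
    obtain ⟨s, t, hs, ht, x, v, hx, h0⟩ := h _ (Nat.le_add_right _ _) (Nat.le_add_left _ _)
    exact ⟨x, v, hx, t, ⟨s, hs, h0⟩, ht⟩
  intro T hT₁ hT₂
  have hin : codeSize (penalizedInput a b I) ≤ S := by simp only [hSdef, N]; omega
  have hsz : codeSize (penalizedInput a b I) = codeSize (a, b) + (codeSize I.cap +
    (codeSize (I.items.map Item.toKItem) + codeSize (I.items.map Item.penalty) + 1) + 1) + 1 := rfl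
  have h0 : (Val.num 0).size ≤ S := by simp only [Val.size, Nat.size_zero]; omega
  have hs : Store.Bdd S (Store.init (code (penalizedInput a b I))) := Store.Bdd.init hin
  refine Ends.assign_seq_eq hs (v := code (a, b)) rfl (by
    change codeSize (a, b) ≤ S; omega) fun hs => ?_
  refine Ends.assign_seq_eq hs (v := code I.cap) rfl (by
    change codeSize I.cap ≤ S; omega) fun hs => ?_
  refine Ends.assign_seq_eq hs (v := code (I.items.map Item.toKItem)) rfl (by
    change codeSize (I.items.map Item.toKItem) ≤ S; omega) fun hs => ?_
  refine Ends.assign_seq_eq hs (v := code (I.items.map Item.penalty)) rfl (by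
    change codeSize (I.items.map Item.penalty) ≤ S; omega) fun hs => ?_
  refine Ends.assign_seq_eq hs (v := .num 0) rfl h0 fun hs => ?_
  refine Ends.seq (Ends.while_loop (P := stackBody) (S := S) (T := 0) (n := I.items.length)
    (I := StackInv S a b I) (fun n s h => h.1) ?_ ?_ ?_
    (le_trans (Nat.mul_le_mul_right _ hlen) hT₁) ?_)
  · rintro s ⟨-, l₁, l₂, -, hn, -, -, h3, -⟩
    obtain rfl := List.length_eq_zero_iff.1 hn
    simpa [Expr.eval, code_nil] using h3
  · intro n s h
    refine ⟨?_, stackBody_ends hin h⟩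
    obtain ⟨-, l₁, l₂, -, hn, -, -, h3, -⟩ := h
    obtain ⟨i, l₂, rfl⟩ := List.exists_cons_of_length_eq_add_one hn
    simp [Expr.eval, h3, code_cons]
  · exact ⟨hs, [], I.items, rfl, rfl, by simp, by simp, by simp, by simp, by simp [code_nil]⟩
  rintro s ⟨hs, l₁, l₂, hI, hn, h1, h2, -, -, h5⟩
  obtain rfl := List.length_eq_zero_iff.1 hn
  rw [List.append_nil] at hI
  subst hI
  refine Ends.assign_seq_eq hs (v := .num 0) rfl h0 fun hs => ?_
  refine Ends.assign_seq_eq hs (v := .num 0) rfl h0 fun hs => ?_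
  refine Ends.assign_seq_eq hs (v := .num 0) rfl h0 fun hs => ?_
  refine Ends.seq (Ends.while_loop (P := scanBody K) (S := S)
    (T := qK.eval (μ (a, b, I)) + q.eval (S + 1)) (n := I.items.length)
    (I := ScanInv S a b (1 - ε) I) (fun n s h => h.1) ?_ ?_ ?_
    (le_trans (Nat.mul_le_mul_right _ hlen) hT₂) ?_)
  · rintro s ⟨-, l₁, l₂, -, hn, -, -, h5, -⟩
    obtain rfl := List.length_eq_zero_iff.1 hn
    simpa [Expr.eval, code_nil] using h5
  · intro n s h
    refine ⟨?_, scanBody_ends le_rfl hq (Nat.le_add_left _ _) ?_ hε₀ hε₁ hC hpen h⟩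
    · obtain ⟨-, l₁, l₂, -, hn, -, -, h5, -⟩ := h
      have hn' : (l₁.reverse.map stackItem).length = n + 1 := by simpa using hn
      obtain ⟨i, l, hl⟩ := List.exists_cons_of_length_eq_add_one hn'
      simp [Expr.eval, h5, hl, code_cons]
    · intro l c hlc
      obtain ⟨-, l₁, l₂, hI, hn, -⟩ := h
      obtain ⟨ha, hb⟩ := hab (by
        intro h0
        rw [h0] at hI
        have := congrArg List.length hI
        simp at this
        omega)
      obtain ⟨z, t, hz, ht, ⟨hzl, hzw⟩, hopt⟩ := hK ⟨l, c⟩ (Set.mem_univ _) a b ha hb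
      refine ⟨z, t, hz, ht.trans (le_trans (eval_mono qK ?_) (Nat.le_add_right _ _)), hzl, hzw,
        fun y hy hyw => ?_⟩
      · exact Nat.add_le_add_right hlc _
      · have := hopt y ⟨hy, hyw⟩
        rw [← hεC]
        exact this
  · refine ⟨hs, I.items, [], by simp, rfl, by simpa using h1, by simpa using h2, by simpa using h5,
      by simp [code_nil], [], 0, by simp [code_nil], by simp [code_nat], IsApprox.nil⟩
  rintro s ⟨hs, l₁, l₂, hI, hn, -, -, -, -, x, v, h7, -, hx⟩
  obtain rfl := List.length_eq_zero_iff.1 hn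
  rw [List.nil_append] at hI
  refine Ends.assign_eq hs rfl ⟨x, v, hI ▸ hx, ?_⟩
  simpa [Expr.eval] using h7

/-- Passing from `ε` to `ε / C` multiplies numerator and denominator by constants: the input grows
by a bounded number of bits, and the reciprocal of the accuracy by at most a constant factor. -/
theorem isFPTAS_schemeA {K : Prog} (hK : IsFPTAS knapsack Set.univ K) {C : ℚ} (hC : 0 < C) :
    IsFPTAS penalizedKnapsack (boundedPenalties C) (schemeA C K) := by
  obtain ⟨Q, hQ⟩ := algorithmA_runs hK
  set n := C.num.toNat with hn
  set d := C.den with hd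
  have hd0 : 0 < d := C.den_pos
  have hn0 : 0 < n := by
    have := Rat.num_pos.2 hC
    omega
  have hCnd : C = (n : ℚ) / d := by
    have h : (n : ℤ) = C.num := Int.toNat_of_nonneg (Rat.num_pos.2 hC).le
    have h' : (n : ℚ) = (C.num : ℚ) := by exact_mod_cast h
    rw [h', hd, Rat.num_div_den]
  let N : ℕ × ℕ × Inst → ℕ := fun i => codeSize (penalizedInput i.1 i.2.1 i.2.2)
  let μ : ℕ × ℕ × Inst → ℕ := fun i => N i + ⌈(i.2.1 : ℚ) / (i.1 : ℚ)⌉₊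
  have hN : PolyBdd μ N := PolyBdd.self.mono fun i => Nat.le_add_right _ _
  have hN' : PolyBdd μ fun i => codeSize (penalizedInput (i.1 * d) (i.2.1 * n) i.2.2) := by
    refine (hN.add (.const (codeSize d + codeSize n))).mono fun i => ?_
    have h₁ := size_mul_le i.1 d
    have h₂ := size_mul_le i.2.1 n
    simp only [N, penalizedInput, codeSize_pair, codeSize_nat]
    omega
  have hceil : PolyBdd μ fun i => ⌈((i.2.1 * n : ℕ) : ℚ) / ((i.1 * d : ℕ) : ℚ)⌉₊ := by
    refine ((PolyBdd.self (μ := μ)).mul (.const n)).mono fun i => ?_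
    refine le_trans (Nat.ceil_le.2 ?_) (Nat.mul_le_mul_right n (Nat.le_add_left _ _))
    have hd1 : (1 : ℚ) ≤ d := by exact_mod_cast hd0
    push_cast
    calc (i.2.1 : ℚ) * n / (i.1 * d) = (i.2.1 : ℚ) / i.1 * n / d := by
          rw [mul_div_mul_comm, div_mul_eq_mul_div, mul_div_assoc', div_mul_eq_mul_div,
            div_right_comm]
      _ ≤ (i.2.1 : ℚ) / i.1 * n := div_le_self (by positivity) hd1
      _ ≤ _ := mul_le_mul_of_nonneg_right (Nat.le_ceil _) (Nat.cast_nonneg n)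
  obtain ⟨R, hR⟩ := (hN.add ((PolyBdd.const 3).mul hN')).prog ((hN'.add hceil).eval Q) (schemeA C K)
  refine ⟨R, fun I hI a b ha hab => ?_⟩
  have hR := hR (a, b, I)
  have hI : ∀ i ∈ I.items, (i.penalty : ℚ) + 1 ≤ C := hI
  have haQ : (0 : ℚ) < a := by exact_mod_cast ha
  have hbQ : (0 : ℚ) < b := by exact_mod_cast ha.trans hab
  have hnQ : (0 : ℚ) < n := by exact_mod_cast hn0
  have hdQ : (0 : ℚ) < d := by exact_mod_cast hd0
  have hε : (a : ℚ) / b ≤ 1 := (div_le_one hbQ).2 (by exact_mod_cast hab.le)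
  -- Any item forces `1 ≤ π + 1 ≤ C`, so `d ≤ n` and the new accuracy is below 1.
  obtain ⟨x, v, t, hx, ht, happ⟩ := hQ (a * d) (b * n) I (a / b) C (by
      intro hne
      obtain ⟨i, l, hl⟩ := List.exists_cons_of_ne_nil hne
      have h₁ := hI i (by simp [hl])
      have h₂ : (0 : ℚ) ≤ i.penalty := Nat.cast_nonneg _
      have h₃ : (1 : ℚ) ≤ n / d := by rw [← hCnd]; linarith
      rw [one_le_div hdQ] at h₃
      have h₄ : d ≤ n := by exact_mod_cast h₃
      refine ⟨Nat.mul_pos ha hd0, lt_of_lt_of_le (Nat.mul_lt_mul_of_pos_right hab hd0) ?_⟩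
      exact Nat.mul_le_mul_left b h₄)
    (by rw [hCnd]; push_cast; field_simp) (by positivity) hε hC hI
  rw [show schemeInput a b (penalizedKnapsack.encode I) = _ from schemeInput_penalized a b I]
  obtain ⟨hlen, hw, hv, hopt⟩ := happ
  have hxs : codeSize x ≤ 3 * codeSize (penalizedInput (a * d) (b * n) I) :=
    codeSize_vector_le _ _ I (l := []) rfl hlen
  obtain ⟨t', hr, ht'⟩ : ∃ t', Runs (schemeA C K) (code (penalizedInput a b I)) (code x) t' ∧
      t' ≤ (schemeA C K).bound (N (a, b, I) + 3 * codeSize (penalizedInput (a * d) (b * n) I))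
        (Q.eval (codeSize (penalizedInput (a * d) (b * n) I) +
          ⌈((b * n : ℕ) : ℚ) / ((a * d : ℕ) : ℚ)⌉₊)) :=
    Ends.runs (Ends.call (Store.Bdd.init (Nat.le_add_right _ _)) hx ht
      (hxs.trans (Nat.le_add_left _ _)) (by simp))
  refine ⟨x, t', hr, ht'.trans hR, ⟨hlen, hw⟩, fun y hy => ?_⟩
  refine (hopt y hy.1 hy.2).trans (le_of_eq ?_)
  change (v : ℚ) = (((selectedSum (fun i : Item => i.profit) x I.items : ℤ) -
    selectedMax Item.penalty x I.items : ℤ) : ℚ)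
  rw [hv]
  norm_cast

end PKP

theorem mainTheorem9 :
    (∃ K : PKP.Prog, PKP.IsFPTAS PKP.knapsack Set.univ K) ∧
    ∀ K : PKP.Prog, PKP.IsFPTAS PKP.knapsack Set.univ K →
      ∀ C : ℚ, 0 < C →
        PKP.IsFPTAS PKP.penalizedKnapsack (PKP.boundedPenalties C) (PKP.schemeA C K) :=
  ⟨PKP.exists_isFPTAS_knapsack, fun _ hK _ hC => PKP.isFPTAS_schemeA hK hC⟩
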